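/- Let $\mathcal H$ be a complex Hilbert space with inner product $\langle\cdot,\cdot\rangle$ linear in the first argument, let $(\psi_n)_{n\in\mathbb Z}$ be unit vectors in $\mathcal H$ whose Gram matrix $G=(\langle\psi_n,\psi_m\rangle)_{n,m\in\mathbb Z}$ is bounded on $\ell^2(\mathbb Z)$ and satisfies $\langle\psi_{n+1},\psi_{m+1}\rangle=\langle\psi_n,\psi_m\rangle$ for all $n,m$. Let $\mathbf P_0$ be a probability measure on $\mathbb R$ whose support is a compact subset of $(0,\infty)$, and let $\varkappa=(\varkappa_n)_{n\in\mathbb Z}$ be i.i.d. with distribution $\mathbf P_0$, i.e. distributed according to $\mathbf P=\prod_{n\in\mathbb Z}\mathbf P_0$ on $\mathbb R^{\mathbb Z}$. Put $$\mathcal P_\varkappa=\sum_{n\in\mathbb Z}\varkappa_n\langle\cdot,\psi_n\rangle\psi_n=\operatorname*{s-lim}_{N\to\infty}\sum_{n=-N}^{N}\varkappa_n\langle\cdot,\psi_n\rangle\psi_n ,\qquad \varphi(k)=\sum_{n\in\mathbb Z}\langle\psi_n,\psi_0\rangle e^{ink}\ \text{ in } L^2(\mathbb T).$$ The function $\varphi$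 is real-valued a.e. Let $\operatorname{essran}\varphi=\{a\in\mathbb R:\operatorname{meas}\{k:|\varphi(k)-a|<\varepsilon\}>0\ \ \forall\varepsilon>0\}$, $\varphi_{\min}=\inf\operatorname{essran}\varphi$, $\varphi_{\max}=\sup\operatorname{essran}\varphi$, $\varkappa_{\min}=\inf\operatorname{supp}\mathbf P_0$, $\varkappa_{\max}=\sup\operatorname{supp}\mathbf P_0$. Write $X\cdot Y=\{xy:x\in X,\ y\in Y\}$ and let $\operatorname{conv}$ denote the closed convex hull. **Theorem.** There is a set $\Sigma\subset\mathbb R$ (the deterministic spectrum) such that, almost surely, the strong limit $\mathcal P_\varkappa$ exists as a bounded operator and $\sigma(\mathcal P_\varkappa)=\Sigma$. It satisfies $$(\operatorname{supp}\mathbf P_0\cdot\operatorname{essran}\varphi)\setminus\{0\}\subset\Sigma,\qquad \Sigma\setminus\{0\}\subset\operatorname{supp}\mathbf P_0\cdot\operatorname{conv}(\operatorname{essran}\varphi),\qquad \max\Sigma=\varkappa_{\max}\varphi_{\max}.$$ Suppose moreover that the following compatibility condition at the point $0$ holds: if the closed linear span of $\{\psi_n\}$ is not $\mathcal H$, then $0\in\operatorname{essran}\varphi$;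 and if it is $\mathcal H$, then $0$ is not an isolated point of $\operatorname{essran}\varphi$. (This always holds for the standard realisation $\psi_n=L_{\sqrt\varphi}\,\delta_n$ in $\mathcal H=\ell^2(\mathbb Z)$, where $(\delta_n)$ is the canonical basis and $L_\theta$ is the Laurent operator, i.e. convolution with the Fourier coefficients of $\theta$.) Then: (i) $\operatorname{supp}\mathbf P_0\cdot\operatorname{essran}\varphi\subset\Sigma\subset\operatorname{supp}\mathbf P_0\cdot\operatorname{conv}(\operatorname{essran}\varphi)$. (ii) $\Sigma\subset[\varkappa_{\min}\varphi_{\min},\varkappa_{\max}\varphi_{\max}]$, $\ \min\Sigma=\varkappa_{\min}\varphi_{\min}$ and $\max\Sigma=\varkappa_{\max}\varphi_{\max}$. In particular, if $\operatorname{essran}\varphi$ is an interval (possibly a single point), then $\Sigma=\operatorname{supp}\mathbf P_0\cdot\operatorname{essran}\varphi$. -/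

import Mathlib

open MeasureTheory Filter Topology Set
open scoped Pointwise

noncomputable section

namespace RandomProjections

/-- The period `2π` is positive, so that Fourier analysis on `AddCircle (2π)` is available. -/
instance two_pi_pos_fact : Fact (0 < 2 * Real.pi) := ⟨Real.two_pi_pos⟩

/-- The unit circle `ℝ / 2πℤ`. -/
abbrev Circ : Type := AddCircle (2 * Real.pi)

/-- Lebesgue measure on the circle, normalised to total mass one. -/
abbrev circMeas : Measure Circ := AddCircle.haarAddCircle

/-- The Hilbert space `ℓ²(ℤ)`. -/
abbrev EllTwo : Type := lp (fun _ : ℤ => ℂ) 2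

/-- The doubly infinite matrix `M` is (the matrix of) a bounded operator on `ℓ²(ℤ)`: there is a
bounded `T` whose value on the `m`-th canonical basis vector is the `m`-th column of `M`. -/
def IsBoundedMatrix (M : ℤ → ℤ → ℂ) : Prop :=
  ∃ T : EllTwo →L[ℂ] EllTwo, ∀ n m : ℤ, T (lp.single 2 m (1 : ℂ)) n = M n m

/-- Essential range of a real function on the circle. -/
def essRan (f : Circ → ℝ) : Set ℝ :=
  {a | ∀ ε > 0, 0 < circMeas {x | |f x - a| < ε}}

variable {H : Type*} [NormedAddCommGroup H] [InnerProductSpace ℂ H]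

/-- The Gram matrix `⟨ψ n, ψ m⟩`, for the inner product that is linear in the *first* argument
(Mathlib's `inner` is linear in the second one). -/
def gramMatrix (ψ : ℤ → H) (n m : ℤ) : ℂ := inner ℂ (ψ m) (ψ n)

/-- The Fourier series `∑ₙ ⟨ψ n, ψ 0⟩ e^{ink}`, as an `L²`-convergent sum. -/
def symbolLp (ψ : ℤ → H) : Lp ℂ 2 circMeas :=
  ∑' n : ℤ, gramMatrix ψ n 0 • fourierLp (T := 2 * Real.pi) 2 n

/-- The symbol, as a real function. (For a shift-invariant Gram matrix the coefficients satisfy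
`c (-n) = conj (c n)`, so that the Fourier series is real almost everywhere.) -/
def symbol (ψ : ℤ → H) : Circ → ℝ := fun x => (symbolLp ψ x).re

/-- The finite sum `∑_{n=-N}^{N} κ n ⟨·, ψ n⟩ ψ n`. -/
def partialOp (ψ : ℤ → H) (κ : ℤ → ℝ) (N : ℕ) : H →L[ℂ] H :=
  ∑ n ∈ Finset.Icc (-(N : ℤ)) (N : ℤ), (κ n : ℂ) • InnerProductSpace.rankOne ℂ (ψ n) (ψ n)

/-- The bounded operator `P` is the sum `∑_{n ∈ ℤ} κ n ⟨·, ψ n⟩ ψ n`, i.e. the strong limit of the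
finite sums. -/
def IsRandomSum (ψ : ℤ → H) (κ : ℤ → ℝ) (P : H →L[ℂ] H) : Prop :=
  ∀ x : H, Tendsto (fun N : ℕ => partialOp ψ κ N x) atTop (𝓝 (P x))

/-- The set `S` of reals is the deterministic spectrum of `∑ₙ κ n ⟨·, ψ n⟩ ψ n`, where the `κ n`
are independent with distribution `P₀`: almost surely the series converges strongly to a bounded
operator whose (complex) spectrum is `S`. -/
def IsDeterministicSpectrum (ψ : ℤ → H) (P₀ : Measure ℝ) [IsProbabilityMeasure P₀]
    (S : Set ℝ) : Prop :=
  ∀ᵐ κ ∂(Measure.infinitePi (fun _ : ℤ => P₀)),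
    ∃ P : H →L[ℂ] H, IsRandomSum ψ κ P ∧ spectrum ℂ P = (fun t : ℝ => (t : ℂ)) '' S

/-- The sequence `ψ` is complete: its closed linear span is the whole space. -/
def IsCompleteSeq (ψ : ℤ → H) : Prop :=
  (Submodule.span ℂ (range ψ)).topologicalClosure = ⊤

/-- Compatibility of the space `H` with the symbol at the point `0`. A vector orthogonal to all
`ψ n` puts `0` into the spectrum, so if there is one, `0` has to lie in the essential range; and if
there is none, then `0` must not be an isolated point of the essential range. Both hold for
`ψ n = L δ_n` in `ℓ²(ℤ)`, where `L` is the Laurent operator with symbol `√φ`, and whenever `ψ` is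
complete and `φ` is nonzero almost everywhere. -/
def ZeroCompatible (ψ : ℤ → H) : Prop :=
  (¬ IsCompleteSeq ψ → (0 : ℝ) ∈ essRan (symbol ψ)) ∧
  (IsCompleteSeq ψ → (0 : ℝ) ∈ essRan (symbol ψ) → AccPt (0 : ℝ) (𝓟 (essRan (symbol ψ))))

end RandomProjections

end

/-! Let `B` be the analysis operator, `T = B B*` the Gram operator and `D` the diagonal operator of
the couplings; the random sum is `B* D B`. For `t ≠ 0`, moving `B*` to the other side gives `t - D B
B* = D (diag (t / κ n) - T)` with `D` invertible, so `t` is spectral iff `T - diag (t / κ n)` is not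
invertible (`mem_spectrum_frameOp_iff`). Randomness thus becomes a diagonal perturbation of an
operator that is multiplication by the symbol in Fourier space. Almost every `κ` contains
approximate copies of every finite pattern of admissible couplings (`ae_isTypical`). Translation
invariance of `T` carries lower bounds from such a copy to the pattern, so a typical spectrum is the
union of the spectra over all admissible sequences. Constant sequences and approximate eigenvectors
of `T` give the lower inclusion. For the upper one, if the values `t / κ n` stay uniformly away from
an interval containing the numerical range of `T`, a sign-splitting argument inverts the difference
(`isUnit_sub_diagOp_of_gap`). The point `0` is separate: it is non-spectral iff `B` is bounded
below, whatever `κ` is. Compatibility is what matches this with the essential range. -/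

noncomputable section

namespace RandomProjections

/-! ### Invertibility criteria for Hilbert space operators. -/

section HilbertOperators

variable {E F : Type*} [NormedAddCommGroup E] [InnerProductSpace ℂ E]
  [NormedAddCommGroup F] [InnerProductSpace ℂ F]

/-- A self-adjoint operator that is bounded below is invertible. -/
theorem isUnit_of_isSelfAdjoint_of_le_norm [CompleteSpace E] {T : E →L[ℂ] E}
    (hT : IsSelfAdjoint T) {c : ℝ} (hc : 0 < c) (h : ∀ x, c * ‖x‖ ≤ ‖T x‖) : IsUnit T := by
  rw [ContinuousLinearMap.isUnit_iff_bijective,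
    ContinuousLinearMap.bijective_iff_dense_range_and_antilipschitz]
  have hsymm := ContinuousLinearMap.isSelfAdjoint_iff_isSymmetric.mp hT
  refine ⟨?_, ⟨⟨c, hc.le⟩⁻¹, ?_⟩⟩
  · rw [Submodule.topologicalClosure_eq_top_iff, Submodule.eq_bot_iff]
    intro x hx
    -- Testing `x ⊥ range T` against `T (T x)` yields `‖T x‖² = 0` by symmetry.
    have h0 : inner ℂ (T (T x)) x = 0 := hx _ ⟨T x, rfl⟩
    have h1 : inner ℂ (T (T x)) x = inner ℂ (T x) (T x) := hsymm (T x) x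
    rw [h1, inner_self_eq_zero] at h0
    have := h x
    rw [h0, norm_zero] at this
    exact norm_eq_zero.mp (le_antisymm (by nlinarith [norm_nonneg x]) (norm_nonneg x))
  · refine ContinuousLinearMap.antilipschitz_of_bound T fun x => ?_
    have : ‖x‖ ≤ c⁻¹ * ‖T x‖ := by
      rw [inv_mul_eq_div, le_div_iff₀ hc, mul_comm]; exact h x
    exact this

theorem exists_le_norm_of_isUnit {T : E →L[ℂ] E} (hT : IsUnit T) :
    ∃ c > 0, ∀ x, c * ‖x‖ ≤ ‖T x‖ := by
  obtain ⟨S, -, hS⟩ := isUnit_iff_exists.mp hT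
  refine ⟨(‖S‖ + 1)⁻¹, by positivity, fun x => ?_⟩
  have h1 : S (T x) = x := by simpa using congrArg (fun U : E →L[ℂ] E => U x) hS
  rw [inv_mul_le_iff₀ (by positivity)]
  calc ‖x‖ = ‖S (T x)‖ := by rw [h1]
    _ ≤ ‖S‖ * ‖T x‖ := S.le_opNorm _
    _ ≤ (‖S‖ + 1) * ‖T x‖ := by gcongr; linarith

/-- If `S` inverts `z - B A`, then `z⁻¹ (1 + A S B)` inverts `z - A B`. Two spaces are allowed
because the swap takes place between `H` and `ℓ²(ℤ)`. -/
theorem isUnit_smul_sub_comp_of_isUnit {A : E →L[ℂ] F} {B : F →L[ℂ] E} {z : ℂ} (hz : z ≠ 0)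
    (h : IsUnit (z • (1 : E →L[ℂ] E) - B ∘L A)) : IsUnit (z • (1 : F →L[ℂ] F) - A ∘L B) := by
  obtain ⟨S, hS1, hS2⟩ := isUnit_iff_exists.mp h
  have h1 : ∀ x, z • S x - B (A (S x)) = x := fun x => by
    simpa using congrArg (fun U : E →L[ℂ] E => U x) hS1
  have h2 : ∀ x, z • S x - S (B (A x)) = x := fun x => by
    simpa using congrArg (fun U : E →L[ℂ] E => U x) hS2
  refine isUnit_iff_exists.mpr ⟨z⁻¹ • (1 + A ∘L S ∘L B), ?_, ?_⟩
  · ext x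
    have h3 := congrArg A (h1 (B x))
    rw [map_sub, map_smul, sub_eq_iff_eq_add] at h3
    change z • (z⁻¹ • (x + A (S (B x)))) - A (B (z⁻¹ • (x + A (S (B x))))) = x
    rw [smul_smul, mul_inv_cancel₀ hz, one_smul, map_smul, map_smul, map_add, map_add, ← h3,
      smul_smul, inv_mul_cancel₀ hz, one_smul, add_sub_cancel_right]
  · ext x
    have h3 := congrArg A (h2 (B x))
    rw [map_sub, map_smul, sub_eq_iff_eq_add] at h3
    change z⁻¹ • ((z • x - A (B x)) + A (S (B (z • x - A (B x))))) = x
    rw [map_sub, map_sub, map_sub, map_smul, map_smul, map_smul, h3, add_sub_cancel_right,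
      sub_add_cancel, smul_smul, inv_mul_cancel₀ hz, one_smul]

theorem isUnit_smul_sub_comp_comm {A : E →L[ℂ] F} {B : F →L[ℂ] E} {z : ℂ} (hz : z ≠ 0) :
    IsUnit (z • (1 : F →L[ℂ] F) - A ∘L B) ↔ IsUnit (z • (1 : E →L[ℂ] E) - B ∘L A) :=
  ⟨isUnit_smul_sub_comp_of_isUnit hz, isUnit_smul_sub_comp_of_isUnit hz⟩

end HilbertOperators

/-! ### Diagonal operators on `ℓ²(ℤ)` and the gap criterion. -/

section Diagonal

theorem memℓp_diag {κ : ℤ → ℝ} {C : ℝ} (hκ : ∀ n, |κ n| ≤ C) (x : EllTwo) :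
    Memℓp (fun n => (κ n : ℂ) * x n) 2 := by
  refine ((lp.memℓp x).norm.const_mul C).mono fun n => ?_
  simp only [norm_mul, Complex.norm_real, Real.norm_eq_abs]
  exact mul_le_mul_of_nonneg_right (hκ n) (norm_nonneg _)

theorem norm_le_mul_of_forall_norm_le {x y : EllTwo} {C : ℝ} (hC : 0 ≤ C)
    (h : ∀ n, ‖x n‖ ≤ C * ‖y n‖) : ‖x‖ ≤ C * ‖y‖ := by
  have : ‖x‖ ≤ ‖(C : ℂ) • y‖ := lp.norm_mono (by norm_num) fun n => by
    rw [lp.coeFn_smul, Pi.smul_apply, norm_smul, Complex.norm_real, Real.norm_of_nonneg hC]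
    exact h n
  rwa [norm_smul, Complex.norm_real, Real.norm_of_nonneg hC] at this

open Classical in
/-- The diagonal operator on `ℓ²(ℤ)` with bounded diagonal `κ` (zero if `κ` is unbounded). -/
def diagOp (κ : ℤ → ℝ) : EllTwo →L[ℂ] EllTwo :=
  if h : ∃ C, ∀ n, |κ n| ≤ C then
    LinearMap.mkContinuous
      { toFun := fun x => ⟨fun n => (κ n : ℂ) * x n, memℓp_diag h.choose_spec x⟩
        map_add' := fun x y => by ext n; exact mul_add _ _ _
        map_smul' := fun c x => by ext n; exact mul_left_comm _ _ _ }
      h.choose fun x => norm_le_mul_of_forall_norm_le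
        ((abs_nonneg _).trans (h.choose_spec 0)) fun n => by
          simpa using mul_le_mul_of_nonneg_right (h.choose_spec n) (norm_nonneg (x n))
  else 0

theorem diagOp_apply {κ : ℤ → ℝ} {C : ℝ} (hκ : ∀ n, |κ n| ≤ C) (x : EllTwo) (n : ℤ) :
    diagOp κ x n = κ n * x n := by
  rw [diagOp, dif_pos ⟨C, hκ⟩]; rfl

theorem diagOp_isSelfAdjoint {κ : ℤ → ℝ} {C : ℝ} (hκ : ∀ n, |κ n| ≤ C) :
    IsSelfAdjoint (diagOp κ) := by
  rw [ContinuousLinearMap.isSelfAdjoint_iff_isSymmetric]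
  intro x y
  simp only [ContinuousLinearMap.coe_coe, lp.inner_eq_tsum]
  congr 1; ext n
  rw [diagOp_apply hκ, diagOp_apply hκ]
  simp only [RCLike.inner_apply, map_mul, Complex.conj_ofReal]; ring

theorem hasSum_norm_sq (x : EllTwo) : HasSum (fun n => ‖x n‖ ^ 2) (‖x‖ ^ 2) := by
  simpa using lp.hasSum_norm (p := 2) (by norm_num) x

theorem hasSum_re_inner_diagOp {κ : ℤ → ℝ} {C : ℝ} (hκ : ∀ n, |κ n| ≤ C) (x : EllTwo) :
    HasSum (fun n => κ n * ‖x n‖ ^ 2) (inner ℂ (diagOp κ x) x).re := by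
  have h := Complex.hasSum_re (lp.hasSum_inner (diagOp κ x) x)
  convert h using 2 with n
  rw [diagOp_apply hκ, RCLike.inner_apply, map_mul, Complex.conj_ofReal, mul_left_comm,
    Complex.mul_conj, Complex.re_ofReal_mul, Complex.normSq_eq_norm_sq, Complex.ofReal_re]

/-- Only indices in the support of `x` contribute, so low and high diagonal values can be estimated
on separate pieces of a vector. -/
theorem re_inner_diagOp_le {κ : ℤ → ℝ} {C c : ℝ} (hκ : ∀ n, |κ n| ≤ C) {x : EllTwo}
    (h : ∀ n, x n = 0 ∨ κ n ≤ c) : (inner ℂ (diagOp κ x) x).re ≤ c * ‖x‖ ^ 2 := by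
  refine hasSum_le (fun n => ?_) (hasSum_re_inner_diagOp hκ x) ((hasSum_norm_sq x).mul_left c)
  rcases h n with h | h
  · simp [h]
  · gcongr

theorem le_re_inner_diagOp {κ : ℤ → ℝ} {C c : ℝ} (hκ : ∀ n, |κ n| ≤ C) {x : EllTwo}
    (h : ∀ n, x n = 0 ∨ c ≤ κ n) : c * ‖x‖ ^ 2 ≤ (inner ℂ (diagOp κ x) x).re := by
  refine hasSum_le (fun n => ?_) ((hasSum_norm_sq x).mul_left c) (hasSum_re_inner_diagOp hκ x)
  rcases h n with h | h
  · simp [h]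
  · gcongr

theorem diagOp_inv_mul {κ : ℤ → ℝ} {a b : ℝ} (ha : 0 < a) (hκ : ∀ n, κ n ∈ Icc a b) :
    diagOp κ * diagOp (fun n => (κ n)⁻¹) = 1 ∧ diagOp (fun n => (κ n)⁻¹) * diagOp κ = 1 := by
  have h1 : ∀ n, |κ n| ≤ b := fun n => by
    rw [abs_of_pos (ha.trans_le (hκ n).1)]; exact (hκ n).2
  have h2 : ∀ n, |(κ n)⁻¹| ≤ a⁻¹ := fun n => by
    rw [abs_of_pos (inv_pos.mpr (ha.trans_le (hκ n).1))]; exact inv_anti₀ ha (hκ n).1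
  have h3 : ∀ n, (κ n : ℂ) ≠ 0 := fun n => by
    exact_mod_cast (ha.trans_le (hκ n).1).ne'
  constructor <;> ext x n
  · simp [diagOp_apply h1, diagOp_apply h2, h3 n]
  · simp [diagOp_apply h1, diagOp_apply h2, h3 n]

/-- If the values of a diagonal avoid a neighbourhood of an interval that contains the numerical
range of a self-adjoint operator, then the difference of the two operators is invertible. -/
theorem isUnit_sub_diagOp_of_gap {T : EllTwo →L[ℂ] EllTwo} (hT : IsSelfAdjoint T) {m M : ℝ}
    (hm : ∀ x, m * ‖x‖ ^ 2 ≤ (inner ℂ (T x) x).re) (hM : ∀ x, (inner ℂ (T x) x).re ≤ M * ‖x‖ ^ 2)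
    {w : ℤ → ℝ} {C δ : ℝ} (hw : ∀ n, |w n| ≤ C) (hδ : 0 < δ)
    (hgap : ∀ n, w n ≤ m - δ ∨ M + δ ≤ w n) : IsUnit (T - diagOp w) := by
  classical
  have hL : IsSelfAdjoint (T - diagOp w) := hT.sub (diagOp_isSelfAdjoint hw)
  have hsymm := ContinuousLinearMap.isSelfAdjoint_iff_isSymmetric.mp hL
  refine isUnit_of_isSelfAdjoint_of_le_norm hL hδ fun x => ?_
  -- Split `x = y + z` by low and high values of `w`. The form of `T - diag w` is at least `δ` on
  -- `y` and at most `-δ` on `z`; pairing its value at `x` with `y - z` cancels the cross terms in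
  -- the real part, and `‖y - z‖ = ‖x‖`.
  set p : ℤ → ℝ := fun n => if w n ≤ m - δ then 1 else 0 with hp
  set q : ℤ → ℝ := fun n => if w n ≤ m - δ then 0 else 1 with hq
  have hp1 : ∀ n, |p n| ≤ 1 := fun n => by simp only [hp]; split_ifs <;> simp
  have hq1 : ∀ n, |q n| ≤ 1 := fun n => by simp only [hq]; split_ifs <;> simp
  set y := diagOp p x
  set z := diagOp q x
  have hyn : ∀ n, y n = p n * x n := diagOp_apply hp1 x
  have hzn : ∀ n, z n = q n * x n := diagOp_apply hq1 x
  have hyz : y + z = x := by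
    ext n
    simp only [lp.coeFn_add, Pi.add_apply, hyn, hzn, hp, hq]
    split_ifs <;> simp
  have horth : inner ℂ y z = 0 := by
    rw [lp.inner_eq_tsum]
    convert tsum_zero with n
    simp only [hyn, hzn, hp, hq]
    split_ifs <;> simp
  have hny : ‖x‖ ^ 2 = ‖y‖ ^ 2 + ‖z‖ ^ 2 := by
    have := norm_add_sq_eq_norm_sq_add_norm_sq_of_inner_eq_zero (𝕜 := ℂ) y z horth
    rw [← hyz]; simpa [sq] using this
  have hnm : ‖y - z‖ ^ 2 = ‖y‖ ^ 2 + ‖z‖ ^ 2 := by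
    have := norm_add_sq_eq_norm_sq_add_norm_sq_of_inner_eq_zero (𝕜 := ℂ) y (-z) (by simp [horth])
    simpa [sq, ← sub_eq_add_neg] using this
  have hnorm : ‖y - z‖ = ‖x‖ := by
    rw [← sq_eq_sq₀ (norm_nonneg _) (norm_nonneg _), hnm, hny]
  have hly : δ * ‖y‖ ^ 2 ≤ (inner ℂ ((T - diagOp w) y) y).re := by
    have h1 : (inner ℂ (diagOp w y) y).re ≤ (m - δ) * ‖y‖ ^ 2 :=
      re_inner_diagOp_le hw fun n => by
        simp only [hyn, hp]; split_ifs with h <;> simp [h]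
    simp only [sub_apply, inner_sub_left, Complex.sub_re]
    linarith [hm y]
  have hlz : (inner ℂ ((T - diagOp w) z) z).re ≤ -(δ * ‖z‖ ^ 2) := by
    have h1 : (M + δ) * ‖z‖ ^ 2 ≤ (inner ℂ (diagOp w z) z).re :=
      le_re_inner_diagOp hw fun n => by
        simp only [hzn, hq]
        split_ifs with h
        · simp
        · exact Or.inr ((hgap n).resolve_left h)
    simp only [sub_apply, inner_sub_left, Complex.sub_re]
    linarith [hM z]
  have hcross : (inner ℂ ((T - diagOp w) y) z).re = (inner ℂ ((T - diagOp w) z) y).re := by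
    have h1 : inner ℂ ((T - diagOp w) y) z = inner ℂ y ((T - diagOp w) z) := hsymm y z
    rw [h1, ← inner_conj_symm, Complex.conj_re]
  have hmain : δ * ‖x‖ ^ 2 ≤ (inner ℂ ((T - diagOp w) x) (y - z)).re := by
    conv_rhs => rw [← hyz]
    rw [map_add, inner_add_left, inner_sub_right, inner_sub_right]
    simp only [Complex.add_re, Complex.sub_re]
    rw [hny]; linarith
  have hfin : δ * ‖x‖ ^ 2 ≤ ‖(T - diagOp w) x‖ * ‖x‖ := by
    calc _ ≤ _ := hmain
      _ ≤ ‖inner ℂ ((T - diagOp w) x) (y - z)‖ := Complex.re_le_norm _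
      _ ≤ _ := norm_inner_le_norm _ _
      _ = _ := by rw [hnorm]
  rcases (norm_nonneg x).eq_or_lt with h | h
  · rw [← h]; simp
  · exact le_of_mul_le_mul_right (by linarith) h

end Diagonal

/-! ### Typical coupling sequences. -/

section Typical

/-- A sequence with values in `K` in which every finite sequence with values in `K` occurs
approximately. -/
def IsTypical (K : Set ℝ) (κ : ℤ → ℝ) : Prop :=
  (∀ n, κ n ∈ K) ∧ ∀ κ' : ℤ → ℝ, (∀ n, κ' n ∈ K) → ∀ L : ℕ, ∀ ε > 0, ∃ j : ℤ,
    ∀ n ∈ Finset.Icc (-(L : ℤ)) L, |κ (n + j) - κ' n| < ε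

/-- Needed because the reflected analysis operator sees the couplings as `κ (-n)`. -/
theorem IsTypical.comp_neg {K : Set ℝ} {κ : ℤ → ℝ} (h : IsTypical K κ) :
    IsTypical K fun n => κ (-n) := by
  refine ⟨fun n => h.1 _, fun κ' hκ' L ε hε => ?_⟩
  obtain ⟨j, hj⟩ := h.2 (fun n => κ' (-n)) (fun n => hκ' _) L ε hε
  refine ⟨-j, fun n hn => ?_⟩
  rw [Finset.mem_Icc] at hn
  have := hj (-n) (Finset.mem_Icc.mpr ⟨by omega, by omega⟩)
  simpa [add_comm] using this

/-- Disjoint windows give independent events of equal positive probability; by the second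
Borel–Cantelli lemma infinitely many occur almost surely. -/
theorem ae_exists_shift_mem (P₀ : Measure ℝ) [IsProbabilityMeasure P₀] (L : ℕ)
    (b : Finset.Icc (-(L : ℤ)) L → Set ℝ) (hb : ∀ n, MeasurableSet (b n))
    (hpos : ∀ n, P₀ (b n) ≠ 0) :
    ∀ᵐ κ ∂(Measure.infinitePi (fun _ : ℤ => P₀)), ∃ j : ℤ, ∀ n, κ (n + j) ∈ b n := by
  set μ := Measure.infinitePi (fun _ : ℤ => P₀)
  -- The stride `2 * L + 1` is the window length, which makes the windows disjoint.
  let e : ℕ × Finset.Icc (-(L : ℤ)) L → ℤ := fun p => p.2 + p.1 * (2 * L + 1)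
  have he : Function.Injective e := by
    rintro ⟨i, n, hn⟩ ⟨i', n', hn'⟩ h
    simp only [e] at h
    rw [Finset.mem_Icc] at hn hn'
    have hi : (i : ℤ) = i' := by
      rcases lt_trichotomy (i : ℤ) i' with h1 | h1 | h1
      · nlinarith
      · exact h1
      · nlinarith
    have hn : n = n' := by rw [hi] at h; exact add_right_cancel h
    have hi' : i = i' := by exact_mod_cast hi
    subst hn hi'; rfl
  have hind := (ProbabilityTheory.iIndepFun_infinitePi (P := fun _ : ℤ => P₀)
    (X := fun _ ω => ω) (fun _ => measurable_id)).precomp he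
  let s : ℕ → Set (ℤ → ℝ) := fun i => ⋂ n, (fun κ : ℤ → ℝ => κ (e (i, n))) ⁻¹' b n
  have hs : ∀ i, MeasurableSet (s i) := fun i =>
    MeasurableSet.iInter fun n => (measurable_pi_apply _) (hb n)
  have hform : ∀ t : Finset ℕ, μ (⋂ i ∈ t, s i) = ∏ i ∈ t, ∏ n, P₀ (b n) := fun t => by
    have h1 := hind.measure_inter_preimage_eq_mul (t ×ˢ Finset.univ)
      (sets := fun p => b p.2) (fun p _ => hb p.2)
    rw [Finset.prod_product] at h1
    convert h1 using 2 with i hi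
    · ext κ
      simp only [s, mem_iInter, Finset.mem_product, Finset.mem_univ, and_true, Prod.forall]
      exact ⟨fun h i n hi => h i hi n, fun h i hi n => h i n hi⟩
    · refine Finset.prod_congr rfl fun n _ => ?_
      exact ((measurePreserving_eval_infinitePi (fun _ : ℤ => P₀) (e (i, n))).measure_preimage
        (hb n).nullMeasurableSet).symm
  have hform1 : ∀ i, μ (s i) = ∏ n, P₀ (b n) := fun i => by simpa using hform {i}
  have hindep : ProbabilityTheory.iIndepSet s μ := by
    rw [ProbabilityTheory.iIndepSet_iff_meas_biInter hs]
    intro t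
    simp_rw [hform t, hform1]
  have hlim := ProbabilityTheory.measure_limsup_eq_one hs hindep (by
    simp_rw [hform1]
    exact ENNReal.tsum_const_eq_top_of_ne_zero (Finset.prod_ne_zero_iff.mpr fun n _ => hpos n))
  rw [← mem_ae_iff_prob_eq_one (MeasurableSet.measurableSet_limsup hs)] at hlim
  filter_upwards [hlim] with κ hκ
  obtain ⟨i, hi⟩ := (mem_limsup_iff_frequently_mem.mp hκ).exists
  exact ⟨i * (2 * L + 1), fun n => mem_iInter.mp hi n⟩

/-- Rational centres and radii `1 / (k + 1)` leave countably many events to intersect. The centres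
need not lie in the support: a ball containing a support point already has positive mass. -/
theorem ae_isTypical (P₀ : Measure ℝ) [IsProbabilityMeasure P₀] :
    ∀ᵐ κ ∂(Measure.infinitePi (fun _ : ℤ => P₀)), IsTypical P₀.support κ := by
  have h1 : ∀ᵐ κ ∂(Measure.infinitePi (fun _ : ℤ => P₀)), ∀ n, κ n ∈ P₀.support :=
    ae_all_iff.mpr fun n =>
      (measurePreserving_eval_infinitePi (fun _ : ℤ => P₀) n).quasiMeasurePreserving.ae
        Measure.support_mem_ae
  have h2 : ∀ᵐ κ ∂(Measure.infinitePi (fun _ : ℤ => P₀)),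
      ∀ (L k : ℕ) (b : Finset.Icc (-(L : ℤ)) L → ℚ),
        (∀ n, P₀ (Metric.ball (b n : ℝ) (1 / (k + 1))) ≠ 0) →
        ∃ j : ℤ, ∀ n, κ (n + j) ∈ Metric.ball (b n : ℝ) (1 / (k + 1)) := by
    simp only [ae_all_iff]
    intro L k b hb
    exact ae_exists_shift_mem P₀ L _ (fun n => measurableSet_ball) hb
  filter_upwards [h1, h2] with κ hκ1 hκ2
  refine ⟨hκ1, fun κ' hκ' L ε hε => ?_⟩
  obtain ⟨k, hk⟩ := exists_nat_one_div_lt (half_pos hε)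
  have hk0 : (0 : ℝ) < 1 / (k + 1) := by positivity
  have hq : ∀ n, ∃ q : ℚ, |κ' n - q| < 1 / (k + 1) := fun n => by
    obtain ⟨q, hq1, hq2⟩ := exists_rat_btwn (show κ' n < κ' n + 1 / (k + 1) by linarith)
    exact ⟨q, by rw [abs_lt]; constructor <;> linarith⟩
  choose q hq using hq
  obtain ⟨j, hj⟩ := hκ2 L k (fun n => q n) fun n =>
    ((Measure.mem_support_iff_forall _).mp (hκ' n) _
      (Metric.isOpen_ball.mem_nhds (by simpa [Real.dist_eq] using hq n))).ne'
  refine ⟨j, fun n hn => ?_⟩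
  have h3 := hj ⟨n, hn⟩
  rw [Metric.mem_ball, Real.dist_eq] at h3
  have h4 := hq n
  rw [abs_lt] at *
  constructor <;> linarith [h3.1, h3.2, h4.1, h4.2]

end Typical

/-! ### The Gram operator as multiplication by its symbol. -/

section Gram

variable {H : Type*} [NormedAddCommGroup H] [InnerProductSpace ℂ H]

/-- The Gram matrix is invariant under simultaneous shifts of both indices. -/
def IsShiftInvariant (ψ : ℤ → H) : Prop :=
  ∀ n m : ℤ, gramMatrix ψ (n + 1) (m + 1) = gramMatrix ψ n m

/-- `T` is the operator on `ℓ²(ℤ)` whose matrix is the Gram matrix of `ψ`. -/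
def IsGramOperator (ψ : ℤ → H) (T : EllTwo →L[ℂ] EllTwo) : Prop :=
  ∀ n m : ℤ, T (lp.single 2 m (1 : ℂ)) n = gramMatrix ψ n m

theorem gramMatrix_conj (ψ : ℤ → H) (n m : ℤ) :
    (starRingEnd ℂ) (gramMatrix ψ n m) = gramMatrix ψ m n := inner_conj_symm _ _

theorem IsShiftInvariant.add {ψ : ℤ → H} (h : IsShiftInvariant ψ) (n m j : ℤ) :
    gramMatrix ψ (n + j) (m + j) = gramMatrix ψ n m := by
  induction j with
  | zero => simp
  | succ j ih => rw [← add_assoc, ← add_assoc, h, ih]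
  | pred j ih =>
    rw [← ih, ← h (n + (-j - 1)) (m + (-j - 1))]
    congr 1 <;> ring

theorem IsShiftInvariant.eq_sub {ψ : ℤ → H} (h : IsShiftInvariant ψ) (n m : ℤ) :
    gramMatrix ψ n m = gramMatrix ψ (n - m) 0 := by
  have := h.add (n - m) 0 m
  simpa using this

theorem IsShiftInvariant.conj_zero {ψ : ℤ → H} (h : IsShiftInvariant ψ) (n : ℤ) :
    (starRingEnd ℂ) (gramMatrix ψ n 0) = gramMatrix ψ (-n) 0 := by
  rw [gramMatrix_conj, h.eq_sub, zero_sub]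

theorem hasSum_apply_single (T : EllTwo →L[ℂ] EllTwo) (x : EllTwo) (n : ℤ) :
    HasSum (fun m => T (lp.single 2 m (1 : ℂ)) n * x m) (T x n) := by
  have h : HasSum (fun m => T (lp.single 2 m (x m)) n) (T x n) :=
    (lp.hasSum_single (by norm_num) x).mapL ((lp.evalCLM ℂ (fun _ : ℤ => ℂ) 2 n).comp T)
  suffices e : (fun m => T (lp.single 2 m (1 : ℂ)) n * x m) = fun m => T (lp.single 2 m (x m)) n by
    rwa [e]
  funext m
  have : lp.single 2 m (x m) = x m • lp.single (E := fun _ : ℤ => ℂ) 2 m (1 : ℂ) := by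
    rw [← lp.single_smul, smul_eq_mul, mul_one]
  rw [this, map_smul, lp.coeFn_smul, Pi.smul_apply, smul_eq_mul, mul_comm]

variable {ψ : ℤ → H} {T : EllTwo →L[ℂ] EllTwo}

theorem IsGramOperator.symbolLp_eq (hT : IsGramOperator ψ T) :
    symbolLp ψ = fourierBasis.repr.symm (T (lp.single 2 0 (1 : ℂ))) := by
  have h := fourierBasis (T := 2 * Real.pi).hasSum_repr_symm (T (lp.single 2 0 (1 : ℂ)))
  rw [coe_fourierBasis] at h
  rw [← h.tsum_eq, symbolLp]
  simp_rw [hT _ 0]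

theorem IsGramOperator.repr_symbolLp (hT : IsGramOperator ψ T) (n : ℤ) :
    fourierBasis.repr (symbolLp ψ) n = gramMatrix ψ n 0 := by
  rw [hT.symbolLp_eq, LinearIsometryEquiv.apply_symm_apply, hT]

theorem fourierCoeff_star (f : Circ → ℂ) (n : ℤ) :
    fourierCoeff (fun x => (starRingEnd ℂ) (f x)) n = (starRingEnd ℂ) (fourierCoeff f (-n)) := by
  simp only [fourierCoeff, smul_eq_mul]
  rw [← integral_conj]
  congr 1; ext x
  rw [map_mul, ← fourier_neg, neg_neg]

/-- The coefficients satisfy `c (-n) = conj (c n)`, so the Fourier series equals its own conjugate.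
-/
theorem symbolLp_ae_eq_symbol (hT : IsGramOperator ψ T) (hs : IsShiftInvariant ψ) :
    ∀ᵐ x ∂circMeas, symbolLp ψ x = symbol ψ x := by
  have hstar : star (symbolLp ψ) = symbolLp ψ := by
    apply fourierBasis.repr.injective
    ext n
    rw [fourierBasis_repr, fourierCoeff_congr_ae (Lp.coeFn_star (symbolLp ψ))]
    have h := fourierCoeff_star (symbolLp ψ) n
    rw [← fourierBasis_repr, hT.repr_symbolLp, hs.conj_zero, neg_neg] at h
    rw [hT.repr_symbolLp, ← h]
    rfl
  have h := Lp.coeFn_star (symbolLp ψ)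
  rw [hstar] at h
  filter_upwards [h] with x hx
  exact (Complex.conj_eq_iff_re.mp hx.symm).symm

theorem memLp_fourier_mul (f : Lp ℂ 2 circMeas) (n : ℤ) :
    MemLp (fun x => fourier n x * f x) 2 circMeas := by
  refine (Lp.memLp f).congr_norm
    ((fourier n).continuous.aestronglyMeasurable.mul (Lp.aestronglyMeasurable f)) ?_
  refine Eventually.of_forall fun x => ?_
  simp [Circle.norm_coe]

/-- In Fourier space the Gram operator is multiplication by the symbol. -/
theorem apply_repr_eq_of_ae_eq_symbol_mul (hT : IsGramOperator ψ T) (hs : IsShiftInvariant ψ)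
    {f g : Lp ℂ 2 circMeas} (hfg : ∀ᵐ x ∂circMeas, g x = symbol ψ x * f x) :
    T (fourierBasis.repr f) = fourierBasis.repr g := by
  have hreal := symbolLp_ae_eq_symbol hT hs
  ext n
  -- With `h = eⁱⁿˣ φ`, the product `⟨h, f⟩` is the `n`-th coefficient of `g`; by Parseval it is
  -- also row `n` of `T` applied to the coefficients of `f`. No bound on `φ` is used.
  set h : Lp ℂ 2 circMeas := (memLp_fourier_mul (symbolLp ψ) n).toLp with hh
  have hcoe : ∀ᵐ x ∂circMeas, h x = fourier n x * symbolLp ψ x := MemLp.coeFn_toLp _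
  have hrepr : ∀ m, fourierBasis.repr h m = gramMatrix ψ (m - n) 0 := fun m => by
    rw [← hT.repr_symbolLp, fourierBasis_repr, fourierBasis_repr, fourierCoeff_congr_ae hcoe]
    simp only [fourierCoeff, smul_eq_mul]
    congr 1; ext x
    rw [← mul_assoc, ← fourier_add]
    congr 3; ring
  have hinner : inner ℂ h f = fourierBasis.repr g n := by
    rw [fourierBasis_repr, fourierCoeff, L2.inner_def]
    refine integral_congr_ae ?_
    filter_upwards [hcoe, hreal, hfg] with x h1 h2 h3
    rw [RCLike.inner_apply, h1, h2, h3, map_mul, Complex.conj_ofReal, fourier_neg, smul_eq_mul]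
    ring
  rw [← hinner, ← fourierBasis.repr.inner_map_map, lp.inner_eq_tsum,
    ← (hasSum_apply_single T (fourierBasis.repr f) n).tsum_eq]
  congr 1; ext m
  rw [hT, hs.eq_sub, hrepr, RCLike.inner_apply, hs.conj_zero, neg_sub, mul_comm]

theorem measurable_symbol (ψ : ℤ → H) : Measurable (symbol ψ) :=
  Complex.measurable_re.comp (Lp.stronglyMeasurable (symbolLp ψ)).measurable

theorem essRan_eq_support {f : Circ → ℝ} (hf : Measurable f) :
    essRan f = (circMeas.map f).support := by
  ext a
  rw [Metric.nhds_basis_ball.mem_measureSupport]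
  refine forall₂_congr fun ε _ => ?_
  rw [Measure.map_apply hf measurableSet_ball]
  rfl

theorem isClosed_essRan_symbol (ψ : ℤ → H) : IsClosed (essRan (symbol ψ)) := by
  rw [essRan_eq_support (measurable_symbol ψ)]; exact Measure.isClosed_support

theorem essRan_symbol_nonempty (ψ : ℤ → H) : (essRan (symbol ψ)).Nonempty := by
  rw [essRan_eq_support (measurable_symbol ψ)]
  have := Measure.isProbabilityMeasure_map (μ := circMeas) (measurable_symbol ψ).aemeasurable
  exact Measure.nonempty_support (IsProbabilityMeasure.ne_zero _)

theorem ae_symbol_mem_essRan (ψ : ℤ → H) : ∀ᵐ x ∂circMeas, symbol ψ x ∈ essRan (symbol ψ) := by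
  rw [essRan_eq_support (measurable_symbol ψ)]
  exact ae_of_ae_map (measurable_symbol ψ).aemeasurable Measure.support_mem_ae

/-- Points of the essential range of the symbol are approximate eigenvalues of the Gram
operator. -/
theorem exists_approx_eigenvector (hT : IsGramOperator ψ T) (hs : IsShiftInvariant ψ) {a : ℝ}
    (ha : a ∈ essRan (symbol ψ)) {ε : ℝ} (hε : 0 < ε) :
    ∃ x : EllTwo, x ≠ 0 ∧ ‖T x - (a : ℂ) • x‖ ≤ ε * ‖x‖ := by
  set S : Set Circ := {x | |symbol ψ x - a| < ε} with hS
  have hSm : MeasurableSet S :=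
    measurableSet_lt ((measurable_symbol ψ).sub_const a).abs measurable_const
  have hSpos : 0 < circMeas S := ha ε hε
  -- On the support of this indicator the symbol is within `ε` of `a`, so multiplication by it
  -- nearly acts as `a`.
  set f : Lp ℂ 2 circMeas := indicatorConstLp 2 hSm (measure_ne_top _ _) (1 : ℂ) with hf
  have hfcoe : ∀ᵐ x ∂circMeas, f x = S.indicator (fun _ => (1 : ℂ)) x := indicatorConstLp_coeFn
  have hgm : MemLp (S.indicator fun x => (symbol ψ x : ℂ)) 2 circMeas := by
    refine MemLp.of_bound ((Complex.measurable_ofReal.comp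
      (measurable_symbol ψ)).indicator hSm).aestronglyMeasurable (|a| + ε)
      (Eventually.of_forall fun x => ?_)
    by_cases hx : x ∈ S
    · rw [indicator_of_mem hx, Complex.norm_real, Real.norm_eq_abs]
      have : |symbol ψ x - a| < ε := hx
      linarith [abs_sub_abs_le_abs_sub (symbol ψ x) a]
    · rw [indicator_of_notMem hx, norm_zero]; positivity
  set g : Lp ℂ 2 circMeas := hgm.toLp with hg
  have hgcoe : ∀ᵐ x ∂circMeas, g x = S.indicator (fun x => (symbol ψ x : ℂ)) x :=
    MemLp.coeFn_toLp _
  refine ⟨fourierBasis.repr f, ?_, ?_⟩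
  · have hf0 : ‖f‖ ≠ 0 := by
      rw [hf, norm_indicatorConstLp (by norm_num) (by norm_num)]
      have : 0 < circMeas.real S := ENNReal.toReal_pos hSpos.ne' (measure_ne_top _ _)
      simp only [norm_one, one_mul]
      positivity
    rw [Ne, ← norm_eq_zero, LinearIsometryEquiv.norm_map]
    exact hf0
  · rw [apply_repr_eq_of_ae_eq_symbol_mul hT hs (g := g), ← map_smul, ← map_sub,
      LinearIsometryEquiv.norm_map, LinearIsometryEquiv.norm_map]
    · refine Lp.norm_le_mul_norm_of_ae_le_mul ?_
      filter_upwards [hfcoe, hgcoe, Lp.coeFn_sub g ((a : ℂ) • f), Lp.coeFn_smul (a : ℂ) f]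
        with x h1 h2 h3 h4
      rw [h3, Pi.sub_apply, h4, Pi.smul_apply, h1, h2]
      by_cases hx : x ∈ S
      · have : |symbol ψ x - a| < ε := hx
        rw [indicator_of_mem hx, indicator_of_mem hx, smul_eq_mul, mul_one, norm_one, mul_one,
          ← Complex.ofReal_sub, Complex.norm_real, Real.norm_eq_abs]
        exact this.le
      · simp [indicator_of_notMem hx]
    · filter_upwards [hfcoe, hgcoe] with x h1 h2
      rw [h1, h2]
      by_cases hx : x ∈ S <;> simp [hx]

/-- Approximate eigenvectors turn positivity and boundedness of `T` into `-ε ≤ a` and `|a| ≤ ‖T‖ +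
ε`. -/
theorem essRan_symbol_subset (hT : IsGramOperator ψ T) (hs : IsShiftInvariant ψ)
    (hpos : ∀ x, 0 ≤ (inner ℂ (T x) x).re) : essRan (symbol ψ) ⊆ Icc 0 ‖T‖ := by
  intro a ha
  constructor
  · refine le_of_forall_pos_le_add fun ε hε => ?_
    obtain ⟨x, hx0, hx⟩ := exists_approx_eigenvector hT hs ha hε
    have hxp : 0 < ‖x‖ := norm_pos_iff.mpr hx0
    have h1 : (inner ℂ (T x - (a : ℂ) • x) x).re ≤ ε * ‖x‖ ^ 2 := by
      calc _ ≤ ‖inner ℂ (T x - (a : ℂ) • x) x‖ := Complex.re_le_norm _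
        _ ≤ _ := norm_inner_le_norm _ _
        _ ≤ ε * ‖x‖ * ‖x‖ := by gcongr
        _ = _ := by ring
    rw [inner_sub_left, inner_smul_left, inner_self_eq_norm_sq_to_K, Complex.conj_ofReal,
      Complex.sub_re, Complex.re_ofReal_mul] at h1
    have h2 : (((‖x‖ : ℝ) : ℂ) ^ 2).re = ‖x‖ ^ 2 := by
      rw [← Complex.ofReal_pow, Complex.ofReal_re]
    have h3 := hpos x
    have h4 : 0 ≤ (a + ε) * ‖x‖ ^ 2 := by
      have : a * ‖x‖ ^ 2 = a * (((‖x‖ : ℝ) : ℂ) ^ 2).re := by rw [h2]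
      have h5 : (inner ℂ (T x) x).re - a * (((‖x‖ : ℝ) : ℂ) ^ 2).re ≤ ε * ‖x‖ ^ 2 := h1
      linarith
    exact nonneg_of_mul_nonneg_left h4 (by positivity)
  · refine le_of_forall_pos_le_add fun ε hε => ?_
    obtain ⟨x, hx0, hx⟩ := exists_approx_eigenvector hT hs ha hε
    have hxp : 0 < ‖x‖ := norm_pos_iff.mpr hx0
    have h1 : ‖(a : ℂ) • x‖ ≤ ‖T x‖ + ‖T x - (a : ℂ) • x‖ := by
      have := norm_sub_le (T x) (T x - (a : ℂ) • x)
      simpa using this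
    rw [norm_smul, Complex.norm_real, Real.norm_eq_abs] at h1
    have h2 := T.le_opNorm x
    have h3 : |a| * ‖x‖ ≤ (‖T‖ + ε) * ‖x‖ := by linarith
    exact (le_abs_self a).trans (le_of_mul_le_mul_right h3 hxp)

theorem exists_lp_eq_symbol_mul {C : ℝ} (hC : ∀ᵐ x ∂circMeas, |symbol ψ x| ≤ C)
    (f : Lp ℂ 2 circMeas) :
    ∃ g : Lp ℂ 2 circMeas, ∀ᵐ x ∂circMeas, g x = symbol ψ x * f x := by
  have : MemLp (fun x => (symbol ψ x : ℂ) * f x) 2 circMeas := by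
    refine (Lp.memLp f).of_le_mul (c := C) ((Complex.measurable_ofReal.comp
      (measurable_symbol ψ)).aestronglyMeasurable.mul (Lp.aestronglyMeasurable f)) ?_
    filter_upwards [hC] with x hx
    rw [norm_mul, Complex.norm_real, Real.norm_eq_abs]
    gcongr
  exact ⟨this.toLp, this.coeFn_toLp⟩

theorem re_inner_nonneg_of_ae {f g : Lp ℂ 2 circMeas} {w : Circ → ℝ}
    (hw : ∀ᵐ x ∂circMeas, 0 ≤ w x) (hg : ∀ᵐ x ∂circMeas, g x = w x * f x) :
    0 ≤ (inner ℂ g f).re := by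
  have h1 := integral_re (L2.integrable_inner (𝕜 := ℂ) g f)
  rw [L2.inner_def]
  refine le_of_le_of_eq ?_ h1
  refine integral_nonneg_of_ae ?_
  filter_upwards [hw, hg] with x h1 h2
  have : inner ℂ (g x) (f x) = ((w x * ‖f x‖ ^ 2 : ℝ) : ℂ) := by
    rw [h2, RCLike.inner_apply, map_mul, Complex.conj_ofReal, mul_left_comm, Complex.mul_conj,
      Complex.normSq_eq_norm_sq, Complex.ofReal_mul]
  simp only [this, Pi.zero_apply]
  change 0 ≤ ((w x * ‖f x‖ ^ 2 : ℝ) : ℂ).re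
  rw [Complex.ofReal_re]; positivity

/-- The numerical range of the Gram operator lies in any interval that contains almost all values
of the symbol. -/
theorem re_inner_gramOperator_mem (hT : IsGramOperator ψ T) (hs : IsShiftInvariant ψ) {m M : ℝ}
    (h : ∀ᵐ x ∂circMeas, symbol ψ x ∈ Icc m M) (x : EllTwo) :
    m * ‖x‖ ^ 2 ≤ (inner ℂ (T x) x).re ∧ (inner ℂ (T x) x).re ≤ M * ‖x‖ ^ 2 := by
  set f : Lp ℂ 2 circMeas := fourierBasis.repr.symm x with hf
  have hfx : fourierBasis.repr f = x := by rw [hf, LinearIsometryEquiv.apply_symm_apply]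
  obtain ⟨g, hg⟩ := exists_lp_eq_symbol_mul (ψ := ψ) (C := max |m| |M|)
    (h.mono fun x hx => abs_le_max_abs_abs hx.1 hx.2) f
  have hTx : T x = fourierBasis.repr g := by
    rw [← hfx]; exact apply_repr_eq_of_ae_eq_symbol_mul hT hs hg
  have hself : (inner ℂ f f).re = ‖f‖ ^ 2 := by
    exact inner_self_eq_norm_sq (𝕜 := ℂ) f
  rw [hTx, ← hfx, fourierBasis.repr.inner_map_map, fourierBasis.repr.norm_map]
  constructor
  · have := re_inner_nonneg_of_ae (f := f) (g := g - (m : ℂ) • f) (w := fun x => symbol ψ x - m)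
      (h.mono fun x hx => sub_nonneg.mpr hx.1) (by
        filter_upwards [hg, Lp.coeFn_sub g ((m : ℂ) • f), Lp.coeFn_smul (m : ℂ) f] with x h1 h2 h3
        rw [h2, Pi.sub_apply, h3, Pi.smul_apply, h1, smul_eq_mul, Complex.ofReal_sub, sub_mul])
    rw [inner_sub_left, inner_smul_left, Complex.conj_ofReal, Complex.sub_re,
      Complex.re_ofReal_mul, hself] at this
    linarith
  · have := re_inner_nonneg_of_ae (f := f) (g := (M : ℂ) • f - g) (w := fun x => M - symbol ψ x)
      (h.mono fun x hx => sub_nonneg.mpr hx.2) (by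
        filter_upwards [hg, Lp.coeFn_sub ((M : ℂ) • f) g, Lp.coeFn_smul (M : ℂ) f] with x h1 h2 h3
        rw [h2, Pi.sub_apply, h3, Pi.smul_apply, h1, smul_eq_mul, Complex.ofReal_sub, sub_mul])
    rw [inner_sub_left, inner_smul_left, Complex.conj_ofReal, Complex.sub_re,
      Complex.re_ofReal_mul, hself] at this
    linarith

end Gram

/-! ### The analysis operator and the factorisation of the random sum. -/

section Analysis

variable {H : Type*} [NormedAddCommGroup H] [InnerProductSpace ℂ H]
  {ψ : ℤ → H} {T : EllTwo →L[ℂ] EllTwo}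

theorem tendsto_Icc_neg_sum {E : Type*} [AddCommMonoid E] [TopologicalSpace E] {f : ℤ → E} {a : E}
    (h : HasSum f a) :
    Tendsto (fun N : ℕ => ∑ n ∈ Finset.Icc (-(N : ℤ)) N, f n) atTop (𝓝 a) := by
  rw [HasSum, SummationFilter.unconditional_filter] at h
  exact h.comp Finset.tendsto_Icc_neg

/-- Shifting both indices by `n + m` undoes the reflection and swaps them. Hence the reflected `B`
satisfies `B B* = T`; without reflection the transpose would appear. -/
theorem gramMatrix_eq_inner_neg (hs : IsShiftInvariant ψ) (n m : ℤ) :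
    inner ℂ (ψ (-n)) (ψ (-m)) = gramMatrix ψ n m := by
  change gramMatrix ψ (-m) (-n) = _
  rw [← hs.add (-m) (-n) (n + m)]
  congr 1 <;> ring

theorem inner_sum_smul_eq (hT : IsGramOperator ψ T) (hs : IsShiftInvariant ψ) (s : Finset ℤ)
    (a : ℤ → ℂ) :
    inner ℂ (∑ n ∈ s, a n • ψ (-n)) (∑ n ∈ s, a n • ψ (-n)) =
      inner ℂ (∑ n ∈ s, lp.single (E := fun _ : ℤ => ℂ) 2 n (a n))
        (T (∑ n ∈ s, lp.single (E := fun _ : ℤ => ℂ) 2 n (a n))) := by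
  rw [sum_inner, sum_inner]
  refine Finset.sum_congr rfl fun n _ => ?_
  rw [inner_sum, map_sum, inner_sum]
  refine Finset.sum_congr rfl fun m _ => ?_
  have : lp.single 2 m (a m) = a m • lp.single (E := fun _ : ℤ => ℂ) 2 m (1 : ℂ) := by
    rw [← lp.single_smul, smul_eq_mul, mul_one]
  rw [this, map_smul, inner_smul_right, inner_smul_right, inner_smul_left,
    gramMatrix_eq_inner_neg hs, lp.inner_single_left, hT, RCLike.inner_apply]
  ring

/-- The Bessel inequality for a sequence with bounded Gram matrix. -/
theorem sum_norm_inner_sq_le (hT : IsGramOperator ψ T) (hs : IsShiftInvariant ψ) (s : Finset ℤ)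
    (x : H) : ∑ n ∈ s, ‖(inner ℂ (ψ (-n)) x : ℂ)‖ ^ 2 ≤ ‖T‖ * ‖x‖ ^ 2 := by
  -- Duality: `y = ∑ a n • ψ (-n)` satisfies `⟨y, x⟩ = Q` and `‖y‖² ≤ ‖T‖ Q`, so Cauchy–Schwarz
  -- gives `Q² ≤ ‖T‖ ‖x‖² Q`.
  set a : ℤ → ℂ := fun n => inner ℂ (ψ (-n)) x with ha
  set Q := ∑ n ∈ s, ‖a n‖ ^ 2 with hQ
  have hQ0 : 0 ≤ Q := Finset.sum_nonneg fun n _ => by positivity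
  set y := ∑ n ∈ s, a n • ψ (-n)
  set v := ∑ n ∈ s, lp.single (E := fun _ : ℤ => ℂ) 2 n (a n)
  have hv : ‖v‖ ^ 2 = Q := by
    have := lp.norm_sum_single (E := fun _ : ℤ => ℂ) (p := 2) (by norm_num) a s
    simpa using this
  have h1 : inner ℂ y x = (Q : ℂ) := by
    rw [sum_inner, hQ, Complex.ofReal_sum]
    refine Finset.sum_congr rfl fun n _ => ?_
    rw [inner_smul_left, mul_comm, Complex.mul_conj, Complex.normSq_eq_norm_sq]
  have h2 : Q ≤ ‖y‖ * ‖x‖ := by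
    have := norm_inner_le_norm (𝕜 := ℂ) y x
    rwa [h1, Complex.norm_real, Real.norm_of_nonneg hQ0] at this
  have h3 : ‖y‖ ^ 2 ≤ ‖T‖ * Q := by
    have h4 : ‖(inner ℂ y y : ℂ)‖ = ‖y‖ ^ 2 := by
      rw [inner_self_eq_norm_sq_to_K]; simp
    rw [← h4, inner_sum_smul_eq hT hs, ← hv]
    calc _ ≤ ‖v‖ * ‖T v‖ := norm_inner_le_norm _ _
      _ ≤ ‖v‖ * (‖T‖ * ‖v‖) := by gcongr; exact T.le_opNorm v
      _ = _ := by ring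
  have h5 : Q * Q ≤ (‖T‖ * ‖x‖ ^ 2) * Q := by
    calc Q * Q ≤ (‖y‖ * ‖x‖) * (‖y‖ * ‖x‖) := mul_self_le_mul_self hQ0 h2
      _ = ‖y‖ ^ 2 * ‖x‖ ^ 2 := by ring
      _ ≤ (‖T‖ * Q) * ‖x‖ ^ 2 := by gcongr
      _ = _ := by ring
  rcases hQ0.eq_or_lt with h | h
  · rw [← h]; positivity
  · exact le_of_mul_le_mul_right h5 h

/-- `B` is the (reflected) analysis operator `x ↦ (⟨x, ψ (-n)⟩)ₙ`. -/
def IsAnalysisOp (ψ : ℤ → H) (B : H →L[ℂ] EllTwo) : Prop :=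
  ∀ x n, B x n = inner ℂ (ψ (-n)) x

theorem exists_analysisOp (hT : IsGramOperator ψ T) (hs : IsShiftInvariant ψ) :
    ∃ B : H →L[ℂ] EllTwo, IsAnalysisOp ψ B := by
  have hmem : ∀ x : H, Memℓp (fun n : ℤ => (inner ℂ (ψ (-n)) x : ℂ)) 2 := fun x =>
    memℓp_gen' (C := ‖T‖ * ‖x‖ ^ 2) fun s => by
      simpa using sum_norm_inner_sq_le hT hs s x
  refine ⟨LinearMap.mkContinuous
    { toFun := fun x => ⟨fun n => inner ℂ (ψ (-n)) x, hmem x⟩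
      map_add' := fun x y => by ext n; exact inner_add_right _ _ _
      map_smul' := fun c x => by ext n; exact inner_smul_right _ _ _ } (√‖T‖) fun x => ?_,
    fun x n => rfl⟩
  refine lp.norm_le_of_forall_sum_le (by norm_num) (by positivity) fun s => ?_
  have := sum_norm_inner_sq_le hT hs s x
  simp only [ENNReal.toReal_ofNat, Real.rpow_ofNat, mul_pow, Real.sq_sqrt (norm_nonneg T)]
  exact this

variable [CompleteSpace H] {B : H →L[ℂ] EllTwo}

theorem IsAnalysisOp.adjoint_single (hB : IsAnalysisOp ψ B) (n : ℤ) (c : ℂ) :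
    B.adjoint (lp.single 2 n c) = c • ψ (-n) := by
  refine ext_inner_right ℂ fun x => ?_
  rw [ContinuousLinearMap.adjoint_inner_left, lp.inner_single_left, hB, inner_smul_left,
    RCLike.inner_apply, mul_comm]

theorem IsAnalysisOp.comp_adjoint (hB : IsAnalysisOp ψ B) (hT : IsGramOperator ψ T)
    (hs : IsShiftInvariant ψ) : B ∘L B.adjoint = T := by
  ext x n
  refine (hasSum_apply_single _ x n).unique ?_
  convert hasSum_apply_single T x n using 3 with m
  rw [hT, ContinuousLinearMap.comp_apply, hB.adjoint_single, hB, one_smul,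
    gramMatrix_eq_inner_neg hs]

theorem re_inner_comp_adjoint_nonneg (B : H →L[ℂ] EllTwo) (x : EllTwo) :
    0 ≤ (inner ℂ ((B ∘L B.adjoint) x) x).re := by
  rw [ContinuousLinearMap.comp_apply, ← ContinuousLinearMap.adjoint_inner_right]
  exact inner_self_nonneg (𝕜 := ℂ)

/-- The operator `B* D B` with a diagonal operator `D`. -/
def frameOp (B : H →L[ℂ] EllTwo) (κ : ℤ → ℝ) : H →L[ℂ] H := B.adjoint ∘L diagOp κ ∘L B

theorem inner_frameOp (B : H →L[ℂ] EllTwo) (κ : ℤ → ℝ) (x : H) :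
    inner ℂ (frameOp B κ x) x = inner ℂ (diagOp κ (B x)) (B x) := by
  rw [frameOp, ContinuousLinearMap.comp_apply, ContinuousLinearMap.comp_apply,
    ContinuousLinearMap.adjoint_inner_left]

theorem frameOp_isSelfAdjoint {κ : ℤ → ℝ} {C : ℝ} (hκ : ∀ n, |κ n| ≤ C) :
    IsSelfAdjoint (frameOp B κ) :=
  (diagOp_isSelfAdjoint hκ).adjoint_conj B

/-- Apply the bounded operator `B* D` to the basis expansion of `B x`. The symmetric windows are
invariant under `n ↦ -n`, so reflection does not change the partial sums. -/
theorem IsAnalysisOp.isRandomSum (hB : IsAnalysisOp ψ B) {κ : ℤ → ℝ} {C : ℝ}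
    (hκ : ∀ n, |κ n| ≤ C) : IsRandomSum ψ κ (frameOp B fun n => κ (-n)) := by
  intro x
  have h : HasSum (fun n => B.adjoint (diagOp (fun n => κ (-n)) (lp.single 2 n (B x n))))
      (frameOp B (fun n => κ (-n)) x) :=
    (lp.hasSum_single (by norm_num) (B x)).mapL (B.adjoint ∘L diagOp fun n => κ (-n))
  refine (tendsto_Icc_neg_sum h).congr fun N => ?_
  rw [partialOp, sum_apply]
  refine Finset.sum_equiv (Equiv.neg ℤ) (fun n => ?_) fun n _ => ?_
  · simp only [Finset.mem_Icc, Equiv.neg_apply]; omega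
  · have : diagOp (fun n => κ (-n)) (lp.single 2 n (B x n)) =
        lp.single 2 n ((κ (-n) : ℂ) * B x n) := by
      ext m
      rw [diagOp_apply fun n => hκ (-n), lp.single_apply, lp.single_apply]
      by_cases hm : m = n
      · subst hm; simp
      · simp [Pi.single_eq_of_ne hm]
    rw [this, hB.adjoint_single, hB, Equiv.neg_apply, smul_apply,
      InnerProductSpace.rankOne_apply, smul_smul]

variable {κ : ℤ → ℝ} {a b : ℝ}

theorem abs_le_of_mem_Icc (ha : 0 < a) (hκ : ∀ n, κ n ∈ Icc a b) (n : ℤ) : |κ n| ≤ b := by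
  rw [abs_of_pos (ha.trans_le (hκ n).1)]; exact (hκ n).2

theorem abs_div_le_of_mem_Icc (ha : 0 < a) (hκ : ∀ n, κ n ∈ Icc a b) (t : ℝ) (n : ℤ) :
    |t / κ n| ≤ |t| / a := by
  rw [abs_div, abs_of_pos (ha.trans_le (hκ n).1)]
  exact div_le_div_of_nonneg_left (abs_nonneg t) ha (hκ n).1

theorem IsAnalysisOp.mem_spectrum_frameOp_iff (hB : IsAnalysisOp ψ B) (hT : IsGramOperator ψ T)
    (hs : IsShiftInvariant ψ) (ha : 0 < a) (hκ : ∀ n, κ n ∈ Icc a b) {t : ℝ} (ht : t ≠ 0) :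
    (t : ℂ) ∈ spectrum ℂ (frameOp B κ) ↔ ¬ IsUnit (T - diagOp fun n => t / κ n) := by
  have hb := abs_le_of_mem_Icc ha hκ
  have ht' : (t : ℂ) ≠ 0 := Complex.ofReal_ne_zero.mpr ht
  have hD : IsUnit (diagOp κ) := isUnit_iff_exists.mpr ⟨_, diagOp_inv_mul ha hκ⟩
  have hfac : (t : ℂ) • (1 : EllTwo →L[ℂ] EllTwo) - (diagOp κ ∘L B) ∘L B.adjoint =
      diagOp κ * -(T - diagOp fun n => t / κ n) := by
    rw [ContinuousLinearMap.comp_assoc, hB.comp_adjoint hT hs, neg_sub, mul_sub]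
    congr 1
    ext x n
    have : (κ n : ℂ) ≠ 0 := Complex.ofReal_ne_zero.mpr (ha.trans_le (hκ n).1).ne'
    change (t : ℂ) * x n = diagOp κ (diagOp (fun n => t / κ n) x) n
    rw [diagOp_apply hb, diagOp_apply (abs_div_le_of_mem_Icc ha hκ t), Complex.ofReal_div,
      ← mul_assoc, mul_div_cancel₀ _ this]
  rw [spectrum.mem_iff, Algebra.algebraMap_eq_smul_one, frameOp, isUnit_smul_sub_comp_comm ht',
    hfac, not_iff_not, ← hD.unit_spec, Units.isUnit_units_mul, IsUnit.neg_iff]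

/-- The form of `B* D B` dominates `a ‖B x‖²`. The criterion does not involve `κ`, so `0` belongs to
all of these spectra or to none. -/
theorem isUnit_frameOp_iff (ha : 0 < a) (hκ : ∀ n, κ n ∈ Icc a b) :
    IsUnit (frameOp B κ) ↔ ∃ c > 0, ∀ x, c * ‖x‖ ≤ ‖B x‖ := by
  have hb := abs_le_of_mem_Icc ha hκ
  constructor
  · intro h
    obtain ⟨c, hc, h⟩ := exists_le_norm_of_isUnit h
    obtain ⟨A, hA⟩ : ∃ A : EllTwo →L[ℂ] H, frameOp B κ = A ∘L B :=
      ⟨B.adjoint ∘L diagOp κ, (ContinuousLinearMap.comp_assoc _ _ _).symm⟩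
    refine ⟨c / (‖A‖ + 1), by positivity, fun x => ?_⟩
    have h1 := h x
    rw [hA, ContinuousLinearMap.comp_apply] at h1
    rw [div_mul_eq_mul_div, div_le_iff₀ (by positivity)]
    linarith [A.le_opNorm (B x), norm_nonneg (B x)]
  · rintro ⟨c, hc, h⟩
    refine isUnit_of_isSelfAdjoint_of_le_norm (c := a * c ^ 2) (frameOp_isSelfAdjoint hb)
      (by positivity) fun x => ?_
    have h1 : a * ‖B x‖ ^ 2 ≤ (inner ℂ (frameOp B κ x) x).re :=
      (le_re_inner_diagOp hb fun n => Or.inr (hκ n).1).trans_eq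
        (congrArg Complex.re (inner_frameOp B κ x)).symm
    have h2 : (c * ‖x‖) ^ 2 ≤ ‖B x‖ ^ 2 := by gcongr; exact h x
    generalize frameOp B κ x = y at h1 ⊢
    have h3 : (inner ℂ y x).re ≤ ‖y‖ * ‖x‖ :=
      (Complex.re_le_norm _).trans (norm_inner_le_norm _ _)
    rcases (norm_nonneg x).eq_or_lt with h0 | h0
    · rw [← h0]; simp
    · refine le_of_mul_le_mul_right ?_ h0
      calc a * c ^ 2 * ‖x‖ * ‖x‖ = a * (c * ‖x‖) ^ 2 := by ring
        _ ≤ a * ‖B x‖ ^ 2 := by gcongr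
        _ ≤ ‖y‖ * ‖x‖ := h1.trans h3

end Analysis

/-! ### Transfer of invertibility along repeated patterns. -/

section Transfer

variable {H : Type*} [NormedAddCommGroup H] [InnerProductSpace ℂ H]
  {ψ : ℤ → H} {T : EllTwo →L[ℂ] EllTwo}

theorem memℓp_comp_sub (x : EllTwo) (j : ℤ) : Memℓp (fun n => x (n - j)) 2 := by
  have h := (hasSum_norm_sq x).summable
  refine memℓp_gen ?_
  simpa [Function.comp_def] using (Equiv.subRight j).summable_iff.mpr h

/-- Translation on `ℓ²(ℤ)`. -/
def translate (j : ℤ) (x : EllTwo) : EllTwo := ⟨fun n => x (n - j), memℓp_comp_sub x j⟩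

theorem translate_apply (j : ℤ) (x : EllTwo) (n : ℤ) : translate j x n = x (n - j) := rfl

theorem norm_translate (j : ℤ) (x : EllTwo) : ‖translate j x‖ = ‖x‖ := by
  rw [← sq_eq_sq₀ (norm_nonneg _) (norm_nonneg _)]
  exact (hasSum_norm_sq (translate j x)).unique
    ((Equiv.subRight j).hasSum_iff.mpr (hasSum_norm_sq x))

theorem IsGramOperator.apply_translate (hT : IsGramOperator ψ T) (hs : IsShiftInvariant ψ) (j : ℤ)
    (x : EllTwo) : T (translate j x) = translate j (T x) := by
  ext n
  refine (hasSum_apply_single T (translate j x) n).unique ?_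
  have h := (Equiv.subRight j).hasSum_iff.mpr (hasSum_apply_single T x (n - j))
  rw [translate_apply]
  refine (congrArg (HasSum · (T x (n - j))) (funext fun m => ?_)).mp h
  simp only [Function.comp_apply, Equiv.subRight_apply, translate_apply]
  rw [hT, hT, sub_eq_add_neg n, sub_eq_add_neg m, hs.add]

theorem IsGramOperator.sub_diagOp_translate (hT : IsGramOperator ψ T) (hs : IsShiftInvariant ψ)
    {w : ℤ → ℝ} {C : ℝ} (hw : ∀ n, |w n| ≤ C) (j : ℤ) (x : EllTwo) :
    (T - diagOp w) (translate j x) = translate j ((T - diagOp fun n => w (n + j)) x) := by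
  ext n
  rw [sub_apply, sub_apply, hT.apply_translate hs, translate_apply, lp.coeFn_sub, lp.coeFn_sub,
    Pi.sub_apply, Pi.sub_apply, diagOp_apply hw, diagOp_apply fun n => hw (n + j), sub_add_cancel]
  rfl

/-- If every finite piece of the diagonal `w'` occurs approximately in `w`, then invertibility of
`T - diag w` implies that of `T - diag w'`. -/
theorem IsGramOperator.isUnit_sub_diagOp_of_pattern (hT : IsGramOperator ψ T)
    (hs : IsShiftInvariant ψ) (hsa : IsSelfAdjoint T) {w w' : ℤ → ℝ} {C : ℝ}
    (hw : ∀ n, |w n| ≤ C) (hw' : ∀ n, |w' n| ≤ C)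
    (hpat : ∀ L : ℕ, ∀ ε > 0, ∃ j : ℤ, ∀ n ∈ Finset.Icc (-(L : ℤ)) L, |w (n + j) - w' n| ≤ ε)
    (h : IsUnit (T - diagOp w)) : IsUnit (T - diagOp w') := by
  obtain ⟨c, hc, hle⟩ := exists_le_norm_of_isUnit h
  refine isUnit_of_isSelfAdjoint_of_le_norm (hsa.sub (diagOp_isSelfAdjoint hw')) (half_pos hc)
    fun x => ?_
  -- The lower bound is a closed condition, so it suffices to check truncations. A truncation is
  -- translated onto a copy of its pattern, where the error `c / 2` leaves half of the bound `c`.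
  have hlim : Tendsto (fun N : ℕ => ∑ n ∈ Finset.Icc (-(N : ℤ)) N, lp.single 2 n (x n)) atTop
      (𝓝 x) := tendsto_Icc_neg_sum (lp.hasSum_single (by norm_num) x)
  have hclosed : IsClosed {x : EllTwo | c / 2 * ‖x‖ ≤ ‖(T - diagOp w') x‖} :=
    isClosed_le (by fun_prop) (by fun_prop)
  refine hclosed.mem_of_tendsto hlim (Eventually.of_forall fun N => ?_)
  set y : EllTwo := ∑ n ∈ Finset.Icc (-(N : ℤ)) N, lp.single 2 n (x n) with hy
  have hy0 : ∀ n, n ∉ Finset.Icc (-(N : ℤ)) N → y n = 0 := fun n hn => by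
    rw [hy, lp.coeFn_sum, Finset.sum_apply]
    refine Finset.sum_eq_zero fun m hm => ?_
    rw [lp.single_apply, Pi.single_eq_of_ne]
    rintro rfl; exact hn hm
  obtain ⟨j, hj⟩ := hpat N (c / 2) (half_pos hc)
  have h1 : c * ‖y‖ ≤ ‖(T - diagOp fun n => w (n + j)) y‖ := by
    have := hle (translate j y)
    rwa [hT.sub_diagOp_translate hs hw, norm_translate, norm_translate] at this
  have h2 : ‖diagOp (fun n => w (n + j)) y - diagOp w' y‖ ≤ c / 2 * ‖y‖ := by
    refine norm_le_mul_of_forall_norm_le (half_pos hc).le fun n => ?_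
    rw [lp.coeFn_sub, Pi.sub_apply, diagOp_apply fun n => hw (n + j), diagOp_apply hw',
      ← sub_mul, norm_mul, ← Complex.ofReal_sub, Complex.norm_real, Real.norm_eq_abs]
    by_cases hn : n ∈ Finset.Icc (-(N : ℤ)) N
    · gcongr; exact hj n hn
    · simp [hy0 n hn]
  have h3 : (T - diagOp w') y =
      (T - diagOp fun n => w (n + j)) y + (diagOp (fun n => w (n + j)) y - diagOp w' y) := by
    simp only [sub_apply]; abel
  change c / 2 * ‖y‖ ≤ ‖(T - diagOp w') y‖
  rw [h3]
  have h4 := norm_sub_le_norm_add ((T - diagOp fun n => w (n + j)) y)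
    (diagOp (fun n => w (n + j)) y - diagOp w' y)
  linarith

theorem IsTypical.pattern_div {K : Set ℝ} {κ κ' : ℤ → ℝ} {a b : ℝ} (ha : 0 < a)
    (hK : K ⊆ Icc a b) (hκ : IsTypical K κ) (hκ' : ∀ n, κ' n ∈ K) (t : ℝ) (L : ℕ) {ε : ℝ}
    (hε : 0 < ε) :
    ∃ j : ℤ, ∀ n ∈ Finset.Icc (-(L : ℤ)) L, |t / κ (n + j) - t / κ' n| ≤ ε := by
  -- The difference of quotients is `|t| |κ' - κ| / (κ κ')` with `κ κ' ≥ a ^ 2`; the `+ 1` covers `t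
  -- = 0`.
  obtain ⟨j, hj⟩ := hκ.2 κ' hκ' L (a ^ 2 * ε / (|t| + 1)) (by positivity)
  refine ⟨j, fun n hn => ?_⟩
  have h1 := (hK (hκ.1 (n + j))).1
  have h2 := (hK (hκ' n)).1
  have h3 := ha.trans_le h1
  have h4 := ha.trans_le h2
  have h5 := hj n hn
  rw [lt_div_iff₀ (by positivity), abs_sub_comm] at h5
  rw [div_sub_div _ _ h3.ne' h4.ne', abs_div, abs_of_pos (mul_pos h3 h4), div_le_iff₀ (by positivity),
    show t * κ' n - κ (n + j) * t = (κ' n - κ (n + j)) * t by ring, abs_mul]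
  calc |κ' n - κ (n + j)| * |t| ≤ |κ' n - κ (n + j)| * (|t| + 1) := by gcongr; linarith
    _ ≤ ε * (a * a) := by linarith
    _ ≤ ε * (κ (n + j) * κ' n) := by gcongr

end Transfer

/-! ### The deterministic spectrum and its bounds. -/

section DeterministicSpectrum

variable {H : Type*} [NormedAddCommGroup H] [InnerProductSpace ℂ H]
  {ψ : ℤ → H} {T : EllTwo →L[ℂ] EllTwo} {B : H →L[ℂ] EllTwo}

theorem IsAnalysisOp.apply_eq_zero_iff (hB : IsAnalysisOp ψ B) {x : H} :
    B x = 0 ↔ x ∈ (Submodule.span ℂ (range ψ))ᗮ := by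
  have h1 : x ∈ (Submodule.span ℂ (range ψ))ᗮ ↔ ∀ n, inner ℂ (ψ n) x = 0 := by
    rw [Submodule.mem_orthogonal]
    refine ⟨fun h n => h _ (Submodule.subset_span ⟨n, rfl⟩), fun h u hu => ?_⟩
    induction hu using Submodule.span_induction with
    | mem u hu => obtain ⟨n, rfl⟩ := hu; exact h n
    | zero => exact inner_zero_left _
    | add u v _ _ hu hv => rw [inner_add_left, hu, hv, add_zero]
    | smul c u _ hu => rw [inner_smul_left, hu, mul_zero]
  rw [h1]
  constructor
  · intro h n
    have := hB x (-n)
    rw [h, neg_neg] at this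
    exact this.symm
  · intro h
    ext n
    rw [hB, h]; rfl

variable [CompleteSpace H]

/-- The union of the spectra of the operators `B* D B` over all diagonals with values in `K`. -/
def unionSpectrum (B : H →L[ℂ] EllTwo) (K : Set ℝ) : Set ℝ :=
  {t | ∃ κ : ℤ → ℝ, (∀ n, κ n ∈ K) ∧ (t : ℂ) ∈ spectrum ℂ (frameOp B κ)}

theorem zero_mem_unionSpectrum_iff {K : Set ℝ} {a b : ℝ} (ha : 0 < a) (hK : K ⊆ Icc a b)
    (hne : K.Nonempty) :
    (0 : ℝ) ∈ unionSpectrum B K ↔ ¬ ∃ c > 0, ∀ x, c * ‖x‖ ≤ ‖B x‖ := by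
  have key : ∀ κ : ℤ → ℝ, (∀ n, κ n ∈ K) →
      (((0 : ℝ) : ℂ) ∈ spectrum ℂ (frameOp B κ) ↔ ¬ ∃ c > 0, ∀ x, c * ‖x‖ ≤ ‖B x‖) :=
    fun κ hκ => by
      rw [Complex.ofReal_zero, spectrum.zero_mem_iff, isUnit_frameOp_iff ha fun n => hK (hκ n)]
  constructor
  · rintro ⟨κ, hκ, h⟩
    exact (key κ hκ).mp h
  · intro h
    obtain ⟨k, hk⟩ := hne
    exact ⟨fun _ => k, fun _ => hk, (key _ fun _ => hk).mpr h⟩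

theorem IsAnalysisOp.spectrum_frameOp_of_isTypical (hB : IsAnalysisOp ψ B)
    (hT : IsGramOperator ψ T) (hs : IsShiftInvariant ψ) (hsa : IsSelfAdjoint T) {K : Set ℝ}
    {a b : ℝ} (ha : 0 < a) (hK : K ⊆ Icc a b) {κ : ℤ → ℝ} (hκ : IsTypical K κ) :
    spectrum ℂ (frameOp B κ) = (fun t : ℝ => (t : ℂ)) '' unionSpectrum B K := by
  have hκI : ∀ n, κ n ∈ Icc a b := fun n => hK (hκ.1 n)
  ext z
  constructor
  · intro hz
    have hre := (frameOp_isSelfAdjoint (B := B) (abs_le_of_mem_Icc ha hκI)).mem_spectrum_eq_re hz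
    exact ⟨z.re, ⟨κ, hκ.1, hre ▸ hz⟩, hre.symm⟩
  · rintro ⟨t, ht, rfl⟩
    by_cases ht0 : t = 0
    · subst ht0
      beta_reduce
      rw [Complex.ofReal_zero, spectrum.zero_mem_iff, isUnit_frameOp_iff ha hκI]
      exact (zero_mem_unionSpectrum_iff ha hK ⟨κ 0, hκ.1 0⟩).mp ht
    · obtain ⟨κ', hκ', h⟩ := ht
      have hκ'I : ∀ n, κ' n ∈ Icc a b := fun n => hK (hκ' n)
      rw [hB.mem_spectrum_frameOp_iff hT hs ha hκ'I ht0] at h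
      simp only [hB.mem_spectrum_frameOp_iff hT hs ha hκI ht0]
      exact fun hu => h (hT.isUnit_sub_diagOp_of_pattern hs hsa
        (abs_div_le_of_mem_Icc ha hκI t) (abs_div_le_of_mem_Icc ha hκ'I t)
        (fun L ε hε => hκ.pattern_div ha hK hκ' t L hε) hu)

theorem IsAnalysisOp.isDeterministicSpectrum (hB : IsAnalysisOp ψ B)
    (hT : IsGramOperator ψ T) (hs : IsShiftInvariant ψ) (hsa : IsSelfAdjoint T)
    (P₀ : Measure ℝ) [IsProbabilityMeasure P₀] {a b : ℝ} (ha : 0 < a)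
    (hK : P₀.support ⊆ Icc a b) :
    IsDeterministicSpectrum ψ P₀ (unionSpectrum B P₀.support) := by
  filter_upwards [ae_isTypical P₀] with κ hκ
  exact ⟨frameOp B fun n => κ (-n),
    hB.isRandomSum (abs_le_of_mem_Icc ha fun n => hK (hκ.1 n)),
    hB.spectrum_frameOp_of_isTypical hT hs hsa ha hK hκ.comp_neg⟩

/-- Some typical sequence exists, so the union is the spectrum of a single operator. -/
theorem IsAnalysisOp.isClosed_unionSpectrum (hB : IsAnalysisOp ψ B)
    (hT : IsGramOperator ψ T) (hs : IsShiftInvariant ψ) (hsa : IsSelfAdjoint T)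
    (P₀ : Measure ℝ) [IsProbabilityMeasure P₀] {a b : ℝ} (ha : 0 < a)
    (hK : P₀.support ⊆ Icc a b) : IsClosed (unionSpectrum B P₀.support) := by
  obtain ⟨κ, hκ⟩ := (ae_isTypical P₀).exists
  have h : unionSpectrum B P₀.support =
      (fun t : ℝ => (t : ℂ)) ⁻¹' spectrum ℂ (frameOp B κ) := by
    rw [hB.spectrum_frameOp_of_isTypical hT hs hsa ha hK hκ,
      preimage_image_eq _ Complex.ofReal_injective]
  rw [h]
  exact (spectrum.isClosed _).preimage Complex.continuous_ofReal

/-- For the constant sequence `k` the perturbed operator is `T - y`, and approximate eigenvectors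
rule out any lower bound. -/
theorem IsAnalysisOp.mul_mem_unionSpectrum (hB : IsAnalysisOp ψ B) (hT : IsGramOperator ψ T)
    (hs : IsShiftInvariant ψ) {K : Set ℝ} {a b : ℝ} (ha : 0 < a) (hK : K ⊆ Icc a b) {k y : ℝ}
    (hk : k ∈ K) (hy : y ∈ essRan (symbol ψ)) (h0 : y ≠ 0) : k * y ∈ unionSpectrum B K := by
  have hk0 : k ≠ 0 := (ha.trans_le (hK hk).1).ne'
  refine ⟨fun _ => k, fun _ => hk, ?_⟩
  rw [hB.mem_spectrum_frameOp_iff hT hs ha (fun _ => hK hk) (mul_ne_zero hk0 h0)]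
  intro hu
  obtain ⟨c, hc, hle⟩ := exists_le_norm_of_isUnit hu
  obtain ⟨x, hx0, hx⟩ := exists_approx_eigenvector hT hs hy (half_pos hc)
  have hxp : 0 < ‖x‖ := norm_pos_iff.mpr hx0
  have h1 : (T - diagOp fun _ => k * y / k) x = T x - (y : ℂ) • x := by
    rw [sub_apply]
    congr 1
    ext n
    rw [diagOp_apply (C := |k * y / k|) fun _ => le_rfl, mul_div_cancel_left₀ _ hk0]
    rfl
  have h2 := hle x
  rw [h1] at h2
  nlinarith

/-- If `t ∉ K * Icc m M`, the compact set of quotients `t / k` keeps a distance `δ` from `Icc m M`,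
possibly with points on both sides, and the gap criterion applies. -/
theorem IsAnalysisOp.mem_mul_Icc_of_mem_unionSpectrum (hB : IsAnalysisOp ψ B)
    (hT : IsGramOperator ψ T) (hs : IsShiftInvariant ψ) (hsa : IsSelfAdjoint T) {K : Set ℝ}
    {a b : ℝ} (ha : 0 < a) (hK : K ⊆ Icc a b) (hKc : IsCompact K) {m M : ℝ} (hmM : m ≤ M)
    (h : ∀ᵐ x ∂circMeas, symbol ψ x ∈ Icc m M) {t : ℝ} (ht : t ∈ unionSpectrum B K)
    (ht0 : t ≠ 0) : t ∈ K * Icc m M := by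
  by_contra hcon
  obtain ⟨κ, hκ, hmem⟩ := ht
  have hκI : ∀ n, κ n ∈ Icc a b := fun n => hK (hκ n)
  rw [hB.mem_spectrum_frameOp_iff hT hs ha hκI ht0] at hmem
  have hcomp : IsCompact ((fun k => t / k) '' K) :=
    hKc.image_of_continuousOn (continuousOn_const.div continuousOn_id fun k hk =>
      (ha.trans_le (hK hk).1).ne')
  have hsub : (fun k => t / k) '' K ⊆ (Icc m M)ᶜ := by
    rintro _ ⟨k, hk, rfl⟩ hmem
    exact hcon ⟨k, hk, t / k, hmem, mul_div_cancel₀ _ (ha.trans_le (hK hk).1).ne'⟩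
  obtain ⟨δ, hδ, hth⟩ := hcomp.exists_thickening_subset_open isClosed_Icc.isOpen_compl hsub
  refine hmem (isUnit_sub_diagOp_of_gap hsa (fun x => (re_inner_gramOperator_mem hT hs h x).1)
    (fun x => (re_inner_gramOperator_mem hT hs h x).2) (abs_div_le_of_mem_Icc ha hκI t) hδ
    fun n => ?_)
  have hin : t / κ n ∈ (fun k => t / k) '' K := mem_image_of_mem _ (hκ n)
  have hfar : ∀ p ∈ Icc m M, δ ≤ |p - t / κ n| := fun p hp => by
    by_contra! hlt
    exact hth (Metric.mem_thickening_iff.mpr ⟨_, hin, by rwa [Real.dist_eq]⟩) hp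
  rcases lt_or_ge (t / κ n) m with hlt | hge
  · left
    have := hfar m ⟨le_rfl, hmM⟩
    rw [abs_of_pos (by linarith)] at this
    linarith
  · right
    have hgt : M < t / κ n := by
      by_contra! hle
      exact hsub hin ⟨hge, hle⟩
    have := hfar M ⟨hmM, le_rfl⟩
    rw [abs_of_neg (by linarith)] at this
    linarith

theorem IsAnalysisOp.not_bddBelow_of_not_isCompleteSeq (hB : IsAnalysisOp ψ B)
    (h : ¬ IsCompleteSeq ψ) : ¬ ∃ c > 0, ∀ x, c * ‖x‖ ≤ ‖B x‖ := by
  rintro ⟨c, hc, hle⟩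
  refine h (Submodule.topologicalClosure_eq_top_iff.mpr ((Submodule.eq_bot_iff _).mpr
    fun x hx => ?_))
  have := hle x
  rw [hB.apply_eq_zero_iff.mpr hx, norm_zero] at this
  exact norm_eq_zero.mp (le_antisymm (by nlinarith [norm_nonneg x]) (norm_nonneg x))

/-- Here `T = B B*` is invertible, so `B x = B (B* y)` for some `y` with `m ‖y‖ ≤ ‖B x‖`.
Completeness makes `B` injective, hence `x = B* y`. -/
theorem IsAnalysisOp.bddBelow_of_isCompleteSeq (hB : IsAnalysisOp ψ B)
    (hT : IsGramOperator ψ T) (hs : IsShiftInvariant ψ) (hsa : IsSelfAdjoint T)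
    (h : IsCompleteSeq ψ) {m : ℝ} (hm : 0 < m)
    (hTm : ∀ x, m * ‖x‖ ^ 2 ≤ (inner ℂ (T x) x).re) : ∃ c > 0, ∀ x, c * ‖x‖ ≤ ‖B x‖ := by
  have hTle : ∀ x, m * ‖x‖ ≤ ‖T x‖ := fun x => by
    rcases (norm_nonneg x).eq_or_lt with h0 | h0
    · rw [← h0, mul_zero]; exact norm_nonneg _
    · refine le_of_mul_le_mul_right ?_ h0
      have := (hTm x).trans ((Complex.re_le_norm _).trans (norm_inner_le_norm (T x) x))
      linarith
  have hsurj := (ContinuousLinearMap.isUnit_iff_bijective.mp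
    (isUnit_of_isSelfAdjoint_of_le_norm hsa hm hTle)).2
  have hbot := Submodule.topologicalClosure_eq_top_iff.mp h
  refine ⟨m / (‖B.adjoint‖ + 1), by positivity, fun x => ?_⟩
  obtain ⟨y, hy⟩ := hsurj (B x)
  have hBy : B (B.adjoint y) = B x := by
    rw [← hy, ← hB.comp_adjoint hT hs, ContinuousLinearMap.comp_apply]
  have hx : B.adjoint y - x = 0 := by
    rw [← Submodule.mem_bot ℂ, ← hbot, ← hB.apply_eq_zero_iff, map_sub, hBy, sub_self]
  have h1 : ‖x‖ ≤ ‖B.adjoint‖ * ‖y‖ := by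
    rw [← sub_eq_zero.mp hx]; exact B.adjoint.le_opNorm y
  have h2 : m * ‖y‖ ≤ ‖B x‖ := hy ▸ hTle y
  rw [div_mul_eq_mul_div, div_le_iff₀ (by positivity)]
  have h3 : ‖B.adjoint‖ * (m * ‖y‖) ≤ ‖B.adjoint‖ * ‖B x‖ := by gcongr
  have h4 : m * ‖x‖ ≤ m * (‖B.adjoint‖ * ‖y‖) := by gcongr
  linarith [norm_nonneg (B x)]

theorem closedConvexHull_eq_Icc {R : Set ℝ} (hR : IsCompact R) (hne : R.Nonempty) :
    closedConvexHull ℝ R = Icc (sInf R) (sSup R) := by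
  refine Subset.antisymm (closedConvexHull_min
    (fun x hx => ⟨csInf_le hR.bddBelow hx, le_csSup hR.bddAbove hx⟩) (convex_Icc _ _)
    isClosed_Icc) ?_
  exact convex_closedConvexHull.ordConnected.out
    (subset_closedConvexHull (hR.sInf_mem hne)) (subset_closedConvexHull (hR.sSup_mem hne))

end DeterministicSpectrum

end RandomProjections

end

/-! ### Assembly of the theorem. -/

theorem mainTheorem5 {H : Type*} [NormedAddCommGroup H] [InnerProductSpace ℂ H] [CompleteSpace H]
    (P₀ : Measure ℝ) [IsProbabilityMeasure P₀]
    (hcpt : IsCompact P₀.support) (hpos : P₀.support ⊆ Ioi 0)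
    (ψ : ℤ → H) (hnorm : ∀ n, ‖ψ n‖ = 1)
    (hbdd : RandomProjections.IsBoundedMatrix (RandomProjections.gramMatrix ψ))
    (hshift : ∀ n m : ℤ, RandomProjections.gramMatrix ψ (n + 1) (m + 1) =
      RandomProjections.gramMatrix ψ n m)
    (K R : Set ℝ) (hK : K = P₀.support)
    (hR : R = RandomProjections.essRan (RandomProjections.symbol ψ)) :
    ∃ S : Set ℝ, RandomProjections.IsDeterministicSpectrum ψ P₀ S ∧
      -- away from the point `0`, for every space `H` and every `ψ`
      ((K * R) \ {0} ⊆ S ∧ S \ {0} ⊆ K * closedConvexHull ℝ R ∧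
        IsGreatest S (sSup K * sSup R)) ∧
      -- including the point `0`
      (RandomProjections.ZeroCompatible ψ →
        K * R ⊆ S ∧ S ⊆ K * closedConvexHull ℝ R ∧
        S ⊆ Icc (sInf K * sInf R) (sSup K * sSup R) ∧
        IsLeast S (sInf K * sInf R) ∧ IsGreatest S (sSup K * sSup R) ∧
        (R.OrdConnected → S = K * R)) := by
  open RandomProjections in
  obtain ⟨T, hT⟩ : ∃ T, IsGramOperator ψ T := hbdd
  have hs : IsShiftInvariant ψ := hshift
  obtain ⟨B, hB⟩ := exists_analysisOp hT hs
  have hsa : IsSelfAdjoint T := by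
    rw [← hB.comp_adjoint hT hs]
    exact ContinuousLinearMap.IsPositive.isSelfAdjoint
      (ContinuousLinearMap.isPositive_self_comp_adjoint B)
  have hTpos : ∀ x, 0 ≤ (inner ℂ (T x) x).re := fun x => by
    rw [← hB.comp_adjoint hT hs]; exact re_inner_comp_adjoint_nonneg B x
  have hRsub : R ⊆ Icc 0 ‖T‖ := hR ▸ essRan_symbol_subset hT hs hTpos
  have hRne : R.Nonempty := hR ▸ essRan_symbol_nonempty ψ
  have hRclosed : IsClosed R := hR ▸ isClosed_essRan_symbol ψ
  have hRcpt : IsCompact R := isCompact_Icc.of_isClosed_subset hRclosed hRsub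
  have hKne : K.Nonempty := hK ▸ Measure.nonempty_support (IsProbabilityMeasure.ne_zero P₀)
  have hKcpt : IsCompact K := hK ▸ hcpt
  have hKpos : ∀ k ∈ K, 0 < k := fun k hk => hpos (hK ▸ hk)
  have hainf := hKcpt.sInf_mem hKne
  have hbsup := hKcpt.sSup_mem hKne
  have hminf := hRcpt.sInf_mem hRne
  have hMsup := hRcpt.sSup_mem hRne
  rw [closedConvexHull_eq_Icc hRcpt hRne]
  set a := sInf K
  set b := sSup K
  set m := sInf R
  set M := sSup R
  have ha : 0 < a := hKpos a hainf
  have hKab : K ⊆ Icc a b := fun k hk =>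
    ⟨csInf_le hKcpt.bddBelow hk, le_csSup hKcpt.bddAbove hk⟩
  have hRmM : R ⊆ Icc m M := fun y hy =>
    ⟨csInf_le hRcpt.bddBelow hy, le_csSup hRcpt.bddAbove hy⟩
  have hm : 0 ≤ m := (hRsub hminf).1
  have hmM : m ≤ M := (hRmM hminf).2
  have hsymb : ∀ᵐ x ∂circMeas, symbol ψ x ∈ Icc m M :=
    (ae_symbol_mem_essRan ψ).mono fun x hx => hRmM (hR ▸ hx)
  -- Testing on the basis vector at `0` gives `1 = ‖ψ 0‖² ≤ M`. So the maximum `b * M` is nonzero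
  -- and needs no compatibility.
  have hM : 0 < M := by
    have h1 := (re_inner_gramOperator_mem hT hs hsymb (lp.single 2 0 (1 : ℂ))).2
    rw [lp.inner_single_right, hT, lp.norm_single (by norm_num), gramMatrix,
      inner_self_eq_norm_sq_to_K, hnorm] at h1
    norm_num at h1
    linarith
  set S := unionSpectrum B K
  have hdet : IsDeterministicSpectrum ψ P₀ S := by
    have := hB.isDeterministicSpectrum hT hs hsa P₀ ha (hK ▸ hKab)
    rwa [← hK] at this
  have hSclosed : IsClosed S := by
    have := hB.isClosed_unionSpectrum hT hs hsa P₀ ha (hK ▸ hKab)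
    rwa [← hK] at this
  have hlow : (K * R) \ {0} ⊆ S := by
    rintro _ ⟨⟨k, hk, y, hy, rfl⟩, h0⟩
    exact hB.mul_mem_unionSpectrum hT hs ha hKab hk (hR ▸ hy) (right_ne_zero_of_mul h0)
  have hup : S \ {0} ⊆ K * Icc m M := fun t ht =>
    hB.mem_mul_Icc_of_mem_unionSpectrum hT hs hsa ha hKab hKcpt hmM hsymb ht.1 ht.2
  have hmulIcc : K * Icc m M ⊆ Icc (a * m) (b * M) := by
    rintro _ ⟨k, hk, y, hy, rfl⟩
    exact ⟨mul_le_mul (hKab hk).1 hy.1 hm (hKpos k hk).le,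
      mul_le_mul (hKab hk).2 hy.2 (hm.trans hy.1) (hKpos b hbsup).le⟩
  have hbM : 0 < b * M := mul_pos (hKpos b hbsup) hM
  have hgreatest : IsGreatest S (b * M) := by
    refine ⟨hlow ⟨⟨b, hbsup, M, hMsup, rfl⟩, hbM.ne'⟩, fun t ht => ?_⟩
    by_cases ht0 : t = 0
    · rw [ht0]; exact hbM.le
    · exact (hmulIcc (hup ⟨ht, ht0⟩)).2
  refine ⟨S, hdet, ⟨hlow, hup, hgreatest⟩, fun hZ => ?_⟩
  rw [ZeroCompatible, ← hR] at hZ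
  -- In the complete case `0` is a limit of nonzero points `a * y` of the closed set `S`; otherwise
  -- `B` has a kernel.
  have hzero1 : (0 : ℝ) ∈ R → (0 : ℝ) ∈ S := fun h0 => by
    by_cases hc : IsCompleteSeq ψ
    · have hfreq := accPt_iff_frequently.mp (hZ.2 hc h0)
      have hlim : Tendsto (fun y : ℝ => a * y) (𝓝 0) (𝓝 0) := by
        simpa using (continuous_const_mul a).tendsto (0 : ℝ)
      refine hSclosed.mem_of_frequently_of_tendsto (hfreq.mono fun y hy => ?_) hlim
      exact hlow ⟨⟨a, hainf, y, hy.2, rfl⟩, mul_ne_zero ha.ne' hy.1⟩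
    · exact (zero_mem_unionSpectrum_iff ha hKab hKne).mpr (hB.not_bddBelow_of_not_isCompleteSeq hc)
  -- In the complete case `m > 0` would bound `B` below and exclude `0` from `S`, so `m = 0`, and
  -- `m` lies in `R`.
  have hzero2 : (0 : ℝ) ∈ S → (0 : ℝ) ∈ R := fun h0 => by
    by_cases hc : IsCompleteSeq ψ
    · rcases hm.eq_or_lt with h | h
      · exact h ▸ hminf
      · exact absurd (hB.bddBelow_of_isCompleteSeq hT hs hsa hc h fun x =>
          (re_inner_gramOperator_mem hT hs hsymb x).1)
          ((zero_mem_unionSpectrum_iff ha hKab hKne).mp h0)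
    · exact hZ.1 hc
  have hlow' : K * R ⊆ S := by
    rintro _ ⟨k, hk, y, hy, rfl⟩
    by_cases hy0 : y = 0
    · subst hy0
      simpa using hzero1 hy
    · exact hlow ⟨⟨k, hk, y, hy, rfl⟩, mul_ne_zero (hKpos k hk).ne' hy0⟩
  have hup' : S ⊆ K * Icc m M := fun t ht => by
    by_cases ht0 : t = 0
    · subst ht0
      exact ⟨a, hainf, 0, hRmM (hzero2 ht), mul_zero a⟩
    · exact hup ⟨ht, ht0⟩
  refine ⟨hlow', hup', hup'.trans hmulIcc, ⟨hlow' ⟨a, hainf, m, hminf, rfl⟩, fun t ht =>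
    (hmulIcc (hup' ht)).1⟩, hgreatest, fun hconn => ?_⟩
  exact Subset.antisymm (hup'.trans (mul_subset_mul_left (hconn.out hminf hMsup))) hlow'
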